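/- Setting. Let $1\le Y\le N$ and let $f=\frac1l\sum_{i=1}^l f_i$, where each $f_i:\mathbb R^N\to\mathbb R$ is differentiable and $\|\nabla f_i(x)-\nabla f_i(y)\|\le L\|x-y\|$ for all $x,y$ ($L\ge 0$). Let $\mu_1,\dots,\mu_N\ge 0$. For a function $g$ put $g^j(x)=\frac1{2\mu_j}\int_{-\mu_j}^{\mu_j}g(x+ve_j)\,dv$, and $g^j=g$ if $\mu_j=0$. For $J\subseteq\{1,\dots,N\}$ with $|J|=Y$ put $$G_J(x;g)=\sum_{j\in J}\frac{N}{2Y\mu_j}\bigl(g(x+\mu_je_j)-g(x-\mu_je_j)\bigr)e_j ,$$ where for $\mu_j=0$ the difference quotient $\frac1{2\mu_j}(g(x+\mu_je_j)-g(x-\mu_je_j))$ is replaced by its limit $\partial_jg(x)$. Let $\widetilde L>0$ and $\widehat L\ge0$ be such that the mixtured gradient $D(x)=\sum_{j}\nabla_jf^j(x)$ (the vector with $j$-th coordinate $\partial_j f^j(x)$) satisfies $\|D(x)-D(y)\|\le\widetilde L\|x-y\|$ and $\|D(x)\|\le\widehat L\|\nabla f(x)\|$ for all $x,y$. The smoothing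 error is $\omega=\frac{L^2}{N}\sum_{j=1}^N\mu_j^2$. AsyDSZOVR with step size $\gamma$, $S$ outer loops, $m$ inner iterations, mini-batch size $b$ and starting point $x^0$: for $s=0,\dots,S-1$ put $\widetilde x^s=x^{s+1}_0=x^s$; for $t=0,\dots,m-1$ read $$\widehat x^{s+1}_t=x^{s+1}_t+\gamma\sum_{t'\in K(t)}B_{t'}\widehat v^{s+1}_{J(t')},$$ where $K(t)\subseteq\{t': 0\le t'<t,\ t-t'\le\tau\}$ and the $B_{t'}$ are diagonal matrices with entries in $\{0,1\}$ ($K(t)$ and these matrices may be random, may change from one iteration to the next, and may depend on everything drawn before iteration $t$ of stage $s$). Then draw, independently of the past and of each other, a mini-batch $\mathcal B(t)$ of $b$ indices from $\{1,\dots,l\}$ (uniformly, with replacement or without replacement) and a uniformly random $Y$-element set $J(t)\subseteq\{1,\dots,N\}$, and set $$\widehat v^{s+1}_{J(t)}=\frac1b\sum_{i\in\mathcal B(t)}G_{J(t)}(\widehat x^{s+1}_t;f_i)-\frac1b\sum_{i\in\mathcal B(t)}G_{J(t)}(\widetilde x^s;f_i)+\frac1l\sum_{i=1}^lG_{J(t)}(\widetilde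 x^s;f_i),\qquad x^{s+1}_{t+1}=x^{s+1}_t-\gamma\,\widehat v^{s+1}_{J(t)};$$ finally $x^{s+1}=x^{s+1}_m$. Put $T=Sm$. Statement. For all $N,Y,\tau,L,\widetilde L,\widehat L$ as above there is $u_*\in(0,1]$, depending only on these six constants, such that for every $u_0\in(0,u_*)$ there is $\sigma>0$, depending only on these constants and $u_0$ (in particular not on $l$, $b$, $\alpha$, $S$, $m$), with the following property. Let $0<\alpha<1$, $1\le b<l^\alpha$, $S\ge1$, $1\le m\le\frac{Yl^\alpha}{5u_0bN^2}$, $\gamma=\frac{u_0b}{\widetilde Ll^\alpha}$, $\beta_t=\frac{\widetilde LN^2}{Y}$, $c_m=0$ and, for $t=m-1,\dots,0$, $$c_t=c_{t+1}(1+\gamma\beta_t)+\Bigl(\frac{c_{t+1}N\gamma^2}{Y}+\frac{LY\gamma^2}{2N}+\frac{\gamma^3NL^2\tau^2}{Y}\Bigr)\frac{4YN\widetilde L^2}{b\,(Y-2N\widetilde L^2\gamma^2\tau^2)} .$$ If $\omega=0$, then $Y-2N\widetilde L^2\gamma^2\tau^2>0$; for $t=0,\dots,m-1$ $$\Gamma_t:=\frac\gamma2-\Bigl(\frac{c_{t+1}N\gamma^2}{Y}+\frac{LY\gamma^2}{2N}+\frac{\gamma^3NL^2\tau^2}{Y}\Bigr)\frac{4Y\widehat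 L}{Y-2N\widetilde L^2\gamma^2\tau^2}\ \ge\ \frac{\sigma b}{\widetilde Ll^\alpha};$$ the expectations below exist and are finite; and $$\frac1T\sum_{s=0}^{S-1}\sum_{t=0}^{m-1}\mathbb E\bigl\|\nabla f(x^{s+1}_t)\bigr\|^2\ \le\ \frac{\widetilde L\,l^\alpha\,\bigl(f(x^0)-\mathbb E f(x^S)\bigr)}{\sigma bT}.$$ -/

import Mathlib

open MeasureTheory ProbabilityTheory

namespace AsyDSZOVR

noncomputable section

/-- The decision space `ℝ^N` with its Euclidean norm. -/
abbrev Vec (N : ℕ) : Type := EuclideanSpace ℝ (Fin N)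

/-- The `j`-th coordinate vector. -/
def e {N : ℕ} (j : Fin N) : Vec N := EuclideanSpace.single j (1 : ℝ)

/-- The finite-sum objective `f = (1 / l) ∑ i, f i`. -/
def avg {N l : ℕ} (f : Fin l → Vec N → ℝ) (x : Vec N) : ℝ :=
  (1 / (l : ℝ)) * ∑ i, f i x

/-- The partial derivative `∇_j g (x)`. -/
def partialD {N : ℕ} (j : Fin N) (g : Vec N → ℝ) (x : Vec N) : ℝ :=
  lineDeriv ℝ g x (e j)

/-! ### Smoothing and zeroth-order gradient estimates -/

/-- The coordinate-wise smoothed function `f^j`: the mean of `g (x + v e_j)` for `v` uniform on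
`[-μ_j, μ_j]`.  For `μ_j = 0` this uniform law is the point mass at `0`. -/
def coordSmooth {N : ℕ} (μ : Fin N → ℝ) (g : Vec N → ℝ) (j : Fin N) (x : Vec N) : ℝ :=
  if μ j = 0 then g x
  else (1 / (2 * μ j)) * ∫ v in (-μ j)..(μ j), g (x + v • e j)

/-- The mixtured gradient `∑ j, ∇_j f^j (x)`, as a vector. -/
def mixGrad {N : ℕ} (μ : Fin N → ℝ) (g : Vec N → ℝ) (x : Vec N) : Vec N :=
  ∑ j, partialD j (coordSmooth μ g j) x • e j

/-- The two-point difference quotient in direction `j`; for `μ_j = 0` its limit, the partial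
derivative. -/
def diffQuot {N : ℕ} (μ : Fin N → ℝ) (g : Vec N → ℝ) (j : Fin N) (x : Vec N) : ℝ :=
  if μ j = 0 then partialD j g x
  else (g (x + μ j • e j) - g (x - μ j • e j)) / (2 * μ j)

/-- The zeroth-order estimate `G_J (x; g)` on the set `J` of (`Y` many) coordinates. -/
def G {N : ℕ} (μ : Fin N → ℝ) (Y : ℕ) (J : Finset (Fin N)) (g : Vec N → ℝ) (x : Vec N) : Vec N :=
  ∑ j ∈ J, (((N : ℝ) / Y) * diffQuot μ g j x) • e j

/-- The smoothing error `ω = L² (∑ j, μ_j²) / N`. -/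
def smoothingError {N : ℕ} (L : ℝ) (μ : Fin N → ℝ) : ℝ :=
  L ^ 2 * (∑ j, μ j ^ 2) / N

/-! ### The algorithm -/

/-- One realisation of everything that is random in a run.  The first index is the outer loop `s`,
the second one the inner iteration `t`. -/
structure Path (N l b : ℕ) where
  /-- the mini-batch `𝓑(t)`, listed as `b` indices -/
  batch : ℕ → ℕ → Fin b → Fin l
  /-- the coordinates `J(t)` -/
  coords : ℕ → ℕ → Finset (Fin N)
  /-- `K(t)`: the earlier inner iterations whose updates the read in iteration `t` may miss -/
  pending : ℕ → ℕ → Finset ℕ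
  /-- `missed s t t'` is the set of coordinates where the 0-1 diagonal matrix `B_{t'}`, used for
  the read in iteration `t`, has the entry `1` -/
  missed : ℕ → ℕ → ℕ → Finset (Fin N)

/-- Multiplication of `v` by the diagonal matrix with entry `1` on `A` and `0` elsewhere. -/
def restrict {N : ℕ} (A : Finset (Fin N)) (v : Vec N) : Vec N :=
  WithLp.toLp 2 fun j => if j ∈ A then v j else 0

/-- The state of an inner loop: the iterate, and the updates `v̂_{J(t')}` computed so far. -/
structure State (N : ℕ) where
  x : Vec N
  upd : ℕ → Vec N

/-- The value `x̂_t = x_t + γ ∑_{t' ∈ K(t)} B_{t'} v̂_{J(t')}` that is read. -/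
def readPoint {N : ℕ} (γ : ℝ) (K : Finset ℕ) (B : ℕ → Finset (Fin N)) (st : State N) : Vec N :=
  st.x + γ • ∑ t' ∈ K, restrict (B t') (st.upd t')

/-- The variance-reduced estimate `v̂_J`, computed from the read point `xh` and the snapshot
`xs`. -/
def estimate {N l b : ℕ} (μ : Fin N → ℝ) (Y : ℕ) (f : Fin l → Vec N → ℝ)
    (I : Fin b → Fin l) (J : Finset (Fin N)) (xh xs : Vec N) : Vec N :=
  (1 / (b : ℝ)) • (∑ k, G μ Y J (f (I k)) xh) - (1 / (b : ℝ)) • (∑ k, G μ Y J (f (I k)) xs)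
    + (1 / (l : ℝ)) • ∑ i, G μ Y J (f i) xs

/-- The inner loop of stage `s`, started at the snapshot `xs`.  As `v̂_J` vanishes off `J`, the
update changes the coordinates in `J` only. -/
def innerLoop {N l b : ℕ} (μ : Fin N → ℝ) (Y : ℕ) (f : Fin l → Vec N → ℝ) (γ : ℝ)
    (p : Path N l b) (s : ℕ) (xs : Vec N) : ℕ → State N
  | 0 => ⟨xs, fun _ => 0⟩
  | t + 1 =>
    let st := innerLoop μ Y f γ p s xs t
    let v := estimate μ Y f (p.batch s t) (p.coords s t)
      (readPoint γ (p.pending s t) (p.missed s t) st) xs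
    ⟨st.x - γ • v, Function.update st.upd t v⟩

/-- The outer iterates `x^s`, with `m` inner iterations in each stage. -/
def outer {N l b : ℕ} (μ : Fin N → ℝ) (Y : ℕ) (f : Fin l → Vec N → ℝ) (γ : ℝ) (m : ℕ)
    (x₀ : Vec N) (p : Path N l b) : ℕ → Vec N
  | 0 => x₀
  | s + 1 => (innerLoop μ Y f γ p s (outer μ Y f γ m x₀ p s) m).x

/-- The inner iterate `x^{s+1}_t`. -/
def iterate {N l b : ℕ} (μ : Fin N → ℝ) (Y : ℕ) (f : Fin l → Vec N → ℝ) (γ : ℝ) (m : ℕ)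
    (x₀ : Vec N) (p : Path N l b) (s t : ℕ) : Vec N :=
  (innerLoop μ Y f γ p s (outer μ Y f γ m x₀ p s) t).x

/-! ### The randomness -/

/-- How the `b` members of a mini-batch are drawn. -/
inductive Sampling where
  | withReplacement
  | withoutReplacement

/-- The equally likely mini-batches: all `b`-tuples of indices, or those with distinct entries
(the latter amounts to a uniformly random set of `b` indices). -/
def batches (mode : Sampling) (b l : ℕ) : Finset (Fin b → Fin l) :=
  match mode with
  | .withReplacement => Finset.univ
  | .withoutReplacement => Finset.univ.filter Function.Injective

/-- `R` is the random path of `S` outer loops of `m` inner iterations of the asynchronous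
algorithm with delay bound `τ`.  The σ-algebra `ℱ (s * m + t)` is the history before the draws of
iteration `(s, t)`. -/
structure IsAsyncRun {Ω : Type*} {mΩ : MeasurableSpace Ω} (P : Measure Ω) (ℱ : Filtration ℕ mΩ)
    {N l b : ℕ} (mode : Sampling) (Y τ S m : ℕ) (R : Ω → Path N l b) : Prop where
  /-- bounded delay, within the current outer loop -/
  delay : ∀ ω, ∀ s < S, ∀ t < m, ∀ t' ∈ (R ω).pending s t, t' < t ∧ t - t' ≤ τ
  /-- what is read depends (arbitrarily) on the history only -/
  pending_meas : ∀ s < S, ∀ t < m, ∀ A,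
    MeasurableSet[ℱ (s * m + t)] {ω | (R ω).pending s t = A}
  missed_meas : ∀ s < S, ∀ t < m, ∀ t' < t, ∀ A,
    MeasurableSet[ℱ (s * m + t)] {ω | (R ω).missed s t t' = A}
  batch_meas : ∀ s < S, ∀ t < m, ∀ I,
    MeasurableSet[ℱ (s * m + t + 1)] {ω | (R ω).batch s t = I}
  coords_meas : ∀ s < S, ∀ t < m, ∀ J,
    MeasurableSet[ℱ (s * m + t + 1)] {ω | (R ω).coords s t = J}
  /-- given the history, the mini-batch and the set of `Y` coordinates are independent and
  uniformly distributed -/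
  uniform : ∀ s < S, ∀ t < m, ∀ H, MeasurableSet[ℱ (s * m + t)] H →
    ∀ I ∈ batches mode b l, ∀ J ∈ Finset.powersetCard Y (Finset.univ : Finset (Fin N)),
      P.real (H ∩ {ω | (R ω).batch s t = I ∧ (R ω).coords s t = J})
        = P.real H * (1 / ((batches mode b l).card : ℝ)) * (1 / (N.choose Y : ℝ))

/-! ### The auxiliary sequences -/

/-- `Y - 2 N L̃² γ² τ²`. -/
def gap (N Y τ : ℕ) (Lt γ : ℝ) : ℝ := Y - 2 * N * Lt ^ 2 * γ ^ 2 * (τ : ℝ) ^ 2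

/-- `c N γ² / Y + L Y γ² / (2 N) + γ³ N L² τ² / Y`. -/
def coeff (N Y τ : ℕ) (L γ c : ℝ) : ℝ :=
  c * N * γ ^ 2 / Y + L * Y * γ ^ 2 / (2 * N) + γ ^ 3 * N * L ^ 2 * (τ : ℝ) ^ 2 / Y

/-- The value of `c_t` obtained from `c = c_{t+1}`. -/
def cStep (N Y τ b : ℕ) (L Lt γ β c : ℝ) : ℝ :=
  c * (1 + γ * β) + coeff N Y τ L γ c * (4 * Y * N * Lt ^ 2 / (b * gap N Y τ Lt γ))

/-- The quantity `Γ_t`, as a function of `c = c_{t+1}`. -/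
def Gam (N Y τ : ℕ) (L Lt Lh γ c : ℝ) : ℝ :=
  γ / 2 - coeff N Y τ L γ c * (4 * Y * Lh / gap N Y τ Lt γ)

end

end AsyDSZOVR

/-! When `ω = 0`, each coordinate has `L = 0` or `μ j = 0`. Then difference quotients are exact
partial derivatives and the mixtured gradient is `∇f`, so `∇f` is `Lt`-Lipschitz and the algorithm
is asynchronous block-coordinate SVRG.

The rate comes from a pathwise argument, with no variance bound. For every outcome of the draws, the
size of `v̂_t` is at most `(N/Y)‖∇f(x_t)‖` plus a multiple of `γ` times the sum of the earlier
`‖v̂_i‖`. Since `γ * m` is bounded by a constant, a discrete Grönwall inequality gives `∑‖v̂_t‖² ≤ C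
∑‖∇f(x_t)‖²` along each inner loop, with `C` independent of `l`, `b`, `m`
(`sum_norm_updateAt_sq_le`). The second-order terms of the descent inequality and the delay errors
`‖x̂_t - x_t‖²` are both controlled by `∑‖v̂_t‖²`. For small `u₀` they consume only half of the main
term `γ/2 * ∑‖∇f(x_t)‖²`, so `γ/4` remains (`avg_innerLoop_le`).

What is left is `∑⟨∇f(x_t), v̂_t - ∇f(x̂_t)⟩`, which has mean zero because `v̂_t` is unbiased given
the history (`integral_inner_updateAt_sub_eq_zero`). Taking expectations and telescoping over the
stages gives the rate.

The sequence `c_t` enters only the bound on `Γ_t`: a backward recursion bounds it by a constant, so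
the subtracted term is `O(γ²)` and `Γ_t ≥ γ/4` (`quarter_le_Gam`). As `γ/4 = (u₀/4) * b / (Lt *
l^α)`, the choice `σ = u₀/4` serves both claims. -/

namespace AsyDSZOVR

/-! ### Real sequences -/

theorem one_add_pow_le_exp {p A : ℝ} {k m : ℕ} (hp : 0 ≤ p) (hkm : k ≤ m) (hA : p * m ≤ A) :
    (1 + p) ^ k ≤ Real.exp A := by
  calc (1 + p) ^ k ≤ (Real.exp p) ^ k := by
        gcongr
        linarith [Real.add_one_le_exp p]
    _ = Real.exp (k * p) := (Real.exp_nat_mul p k).symm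
    _ ≤ Real.exp A := by
        gcongr
        have : (k : ℝ) ≤ m := by exact_mod_cast hkm
        nlinarith

/-- A discrete Grönwall inequality. -/
theorem sum_range_le_of_le_add_sum {w g : ℕ → ℝ} {a ρ : ℝ} {m : ℕ} (ha : 0 ≤ a) (hρ : 0 ≤ ρ)
    (hg : ∀ t, 0 ≤ g t)
    (h : ∀ t < m, w t ≤ ρ * g t + a * ∑ i ∈ Finset.range t, w i) :
    ∀ t ≤ m, ∑ i ∈ Finset.range t, w i ≤ (1 + a) ^ t * (ρ * ∑ i ∈ Finset.range t, g i) := by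
  intro t
  induction t with
  | zero => simp
  | succ t ih =>
    intro ht
    have h1 := ih (by omega)
    have h2 := h t (by omega)
    have h3 : (1 : ℝ) ≤ (1 + a) ^ (t + 1) := one_le_pow₀ (by linarith)
    have h4 : 0 ≤ ρ * g t := mul_nonneg hρ (hg t)
    have h5 := mul_le_mul_of_nonneg_left h1 (by linarith : 0 ≤ 1 + a)
    have h6 := mul_le_mul_of_nonneg_right h3 h4
    rw [Finset.sum_range_succ, Finset.sum_range_succ]
    calc _ ≤ (1 + a) * ∑ i ∈ Finset.range t, w i + ρ * g t := by linarith
      _ ≤ (1 + a) * ((1 + a) ^ t * (ρ * ∑ i ∈ Finset.range t, g i))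
          + (1 + a) ^ (t + 1) * (ρ * g t) := by linarith
      _ = _ := by ring

/-- Grönwall bounds the partial sums of `w` by those of `g`. Cauchy–Schwarz in `(∑ g)²` costs one
factor `m` and summing over `t` another; both are absorbed by `a²`, because `a * m ≤ A`. Hence the
constant is free of `m`. -/
theorem sum_sq_le_of_le_add_sum {w g : ℕ → ℝ} {a ρ A : ℝ} {m : ℕ} (ha : 0 ≤ a) (hρ : 0 ≤ ρ)
    (hA : a * m ≤ A) (hg : ∀ t, 0 ≤ g t) (hw : ∀ t, 0 ≤ w t)
    (h : ∀ t < m, w t ≤ ρ * g t + a * ∑ i ∈ Finset.range t, w i) :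
    ∑ t ∈ Finset.range m, w t ^ 2
      ≤ 2 * ρ ^ 2 * (1 + A ^ 2 * Real.exp A ^ 2) * ∑ t ∈ Finset.range m, g t ^ 2 := by
  set Q := ∑ t ∈ Finset.range m, g t ^ 2
  have hQ : 0 ≤ Q := Finset.sum_nonneg fun _ _ => sq_nonneg _
  have hG : (∑ i ∈ Finset.range m, g i) ^ 2 ≤ m * Q := by
    simpa using sq_sum_le_card_mul_sum_sq (s := Finset.range m) (f := g)
  have hWb : ∀ t ≤ m, (∑ i ∈ Finset.range t, w i) ^ 2 ≤ Real.exp A ^ 2 * ρ ^ 2 * (m * Q) := by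
    intro t ht
    have h1 : ∑ i ∈ Finset.range t, w i ≤ Real.exp A * (ρ * ∑ i ∈ Finset.range m, g i) := by
      refine (sum_range_le_of_le_add_sum ha hρ hg h t ht).trans ?_
      have := one_add_pow_le_exp ha ht hA
      have h0 : 0 ≤ ∑ i ∈ Finset.range t, g i := Finset.sum_nonneg fun _ _ => hg _
      have : ∑ i ∈ Finset.range t, g i ≤ ∑ i ∈ Finset.range m, g i :=
        Finset.sum_le_sum_of_subset_of_nonneg (Finset.range_mono ht) fun _ _ _ => hg _
      gcongr
    calc _ ≤ (Real.exp A * (ρ * ∑ i ∈ Finset.range m, g i)) ^ 2 :=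
          pow_le_pow_left₀ (Finset.sum_nonneg fun _ _ => hw _) h1 2
      _ = Real.exp A ^ 2 * ρ ^ 2 * (∑ i ∈ Finset.range m, g i) ^ 2 := by ring
      _ ≤ _ := by gcongr
  have hterm : ∀ t ∈ Finset.range m, w t ^ 2
      ≤ 2 * ρ ^ 2 * g t ^ 2 + 2 * a ^ 2 * (Real.exp A ^ 2 * ρ ^ 2 * (m * Q)) := by
    intro t ht
    have htm := Finset.mem_range.1 ht
    have h1 := hWb t htm.le
    have h2 := pow_le_pow_left₀ (hw t) (h t htm) 2
    have h3 := mul_le_mul_of_nonneg_left h1 (by positivity : 0 ≤ 2 * a ^ 2)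
    nlinarith [sq_nonneg (ρ * g t - a * ∑ i ∈ Finset.range t, w i)]
  have ha2 : (a * m) ^ 2 ≤ A ^ 2 := pow_le_pow_left₀ (by positivity) hA 2
  calc _ ≤ ∑ t ∈ Finset.range m,
        (2 * ρ ^ 2 * g t ^ 2 + 2 * a ^ 2 * (Real.exp A ^ 2 * ρ ^ 2 * (m * Q))) :=
        Finset.sum_le_sum hterm
    _ = 2 * ρ ^ 2 * Q + (a * m) ^ 2 * (2 * (Real.exp A ^ 2 * ρ ^ 2 * Q)) := by
        rw [Finset.sum_add_distrib, ← Finset.mul_sum, Finset.sum_const, Finset.card_range,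
          nsmul_eq_mul]
        ring
    _ ≤ 2 * ρ ^ 2 * Q + A ^ 2 * (2 * (Real.exp A ^ 2 * ρ ^ 2 * Q)) := by gcongr
    _ = _ := by ring

/-- Sums over windows of length `τ` add up to at most `τ` times the whole sum. -/
theorem sum_sq_window_le {w : ℕ → ℝ} {m τ : ℕ} {K : ℕ → Finset ℕ}
    (hK : ∀ t < m, ∀ i ∈ K t, i < t ∧ t - i ≤ τ) :
    ∑ t ∈ Finset.range m, (∑ i ∈ K t, w i) ^ 2
      ≤ (τ : ℝ) ^ 2 * ∑ t ∈ Finset.range m, w t ^ 2 := by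
  have hcard : ∀ t < m, ((K t).card : ℝ) ≤ τ := by
    intro t ht
    have : K t ⊆ Finset.Ico (t - τ) t := fun i hi => by
      have := hK t ht i hi
      rw [Finset.mem_Ico]; omega
    have := Finset.card_le_card this
    rw [Nat.card_Ico] at this
    exact_mod_cast this.trans (by omega)
  have h1 : ∀ t ∈ Finset.range m, (∑ i ∈ K t, w i) ^ 2
      ≤ τ * ∑ i ∈ Finset.range m, if i < t ∧ t - i ≤ τ then w i ^ 2 else 0 := by
    intro t ht
    have htm := Finset.mem_range.1 ht
    calc _ ≤ ((K t).card : ℝ) * ∑ i ∈ K t, w i ^ 2 := sq_sum_le_card_mul_sum_sq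
      _ ≤ τ * ∑ i ∈ K t, w i ^ 2 :=
        mul_le_mul_of_nonneg_right (hcard t htm) (Finset.sum_nonneg fun _ _ => sq_nonneg _)
      _ ≤ _ := by
        gcongr
        rw [← Finset.sum_filter]
        refine Finset.sum_le_sum_of_subset_of_nonneg (fun i hi => ?_) fun _ _ _ => sq_nonneg _
        have := hK t htm i hi
        rw [Finset.mem_filter, Finset.mem_range]
        omega
  -- One factor `τ` came from Cauchy–Schwarz in each window; exchanging the sums yields the other,
  -- as each `i` lies in at most `τ` windows.
  refine (Finset.sum_le_sum h1).trans ?_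
  rw [← Finset.mul_sum, Finset.sum_comm, sq, mul_assoc]
  refine mul_le_mul_of_nonneg_left ?_ (Nat.cast_nonneg τ)
  rw [Finset.mul_sum]
  refine Finset.sum_le_sum fun i _ => ?_
  rw [← Finset.sum_filter, Finset.sum_const, nsmul_eq_mul]
  have : (Finset.range m).filter (fun t => i < t ∧ t - i ≤ τ) ⊆ Finset.Ioc i (i + τ) := by
    intro t ht
    rw [Finset.mem_filter] at ht
    rw [Finset.mem_Ioc]; omega
  have := Finset.card_le_card this
  rw [Nat.card_Ioc, Nat.add_sub_cancel_left] at this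
  have : (((Finset.range m).filter (fun t => i < t ∧ t - i ≤ τ)).card : ℝ) ≤ τ := by
    exact_mod_cast this
  gcongr

/-- Iterating `k = m - t` steps down from `c m = 0` gives `k * q * (1 + p) ^ k`. Nonnegativity is
carried along because the one-step bound is available only for `0 ≤ c (t + 1)`. -/
theorem backward_recursion_le {c : ℕ → ℝ} {m : ℕ} {p q A : ℝ} (hp : 0 ≤ p) (hq : 0 ≤ q)
    (hA : p * m ≤ A) (hcm : c m = 0)
    (hc : ∀ t < m, 0 ≤ c (t + 1) → 0 ≤ c t ∧ c t ≤ c (t + 1) * (1 + p) + q) :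
    ∀ t ≤ m, 0 ≤ c t ∧ c t ≤ m * q * Real.exp A := by
  have key : ∀ k ≤ m, 0 ≤ c (m - k) ∧ c (m - k) ≤ k * q * (1 + p) ^ k := by
    intro k
    induction k with
    | zero => simp [hcm]
    | succ k ih =>
      intro hk
      obtain ⟨h1, h2⟩ := ih (by omega)
      have e : m - (k + 1) + 1 = m - k := by omega
      have := hc (m - (k + 1)) (by omega) (by rwa [e])
      rw [e] at this
      refine ⟨this.1, this.2.trans ?_⟩
      have h3 : (1 : ℝ) ≤ (1 + p) ^ (k + 1) := one_le_pow₀ (by linarith)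
      have h4 := mul_le_mul_of_nonneg_right h2 (by linarith : 0 ≤ 1 + p)
      have h5 := mul_le_mul_of_nonneg_left h3 hq
      push_cast
      calc _ ≤ k * q * (1 + p) ^ k * (1 + p) + q * (1 + p) ^ (k + 1) := by linarith
        _ = _ := by ring
  intro t ht
  obtain ⟨h1, h2⟩ := key (m - t) (by omega)
  have e : m - (m - t) = t := by omega
  rw [e] at h1 h2
  refine ⟨h1, h2.trans ?_⟩
  have := one_add_pow_le_exp hp (Nat.sub_le m t) hA
  have : ((m - t : ℕ) : ℝ) ≤ m := by exact_mod_cast Nat.sub_le m t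
  gcongr

/-! ### The auxiliary sequences -/

theorem coeff_le {N Y τ : ℕ} {L Lt γ c : ℝ} (hLt : 0 < Lt) (hγ1 : γ * Lt ≤ 1) :
    coeff N Y τ L γ c
      ≤ γ ^ 2 * (c * N / Y + (L * Y / (2 * N) + N * L ^ 2 * (τ : ℝ) ^ 2 / (Y * Lt))) := by
  have h1 : γ ≤ 1 / Lt := by rwa [le_div_iff₀ hLt]
  have h2 : γ ^ 3 * N * L ^ 2 * (τ : ℝ) ^ 2 / Y
      ≤ γ ^ 2 * (N * L ^ 2 * (τ : ℝ) ^ 2 / (Y * Lt)) := by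
    calc _ = γ ^ 2 * (N * L ^ 2 * (τ : ℝ) ^ 2 / Y) * γ := by ring
      _ ≤ γ ^ 2 * (N * L ^ 2 * (τ : ℝ) ^ 2 / Y) * (1 / Lt) := by gcongr
      _ = _ := by ring
  calc coeff N Y τ L γ c = γ ^ 2 * (c * N / Y + L * Y / (2 * N))
        + γ ^ 3 * N * L ^ 2 * (τ : ℝ) ^ 2 / Y := by unfold coeff; ring
    _ ≤ _ := by linarith

theorem coeff_nonneg {N Y τ : ℕ} {L γ c : ℝ} (hL : 0 ≤ L) (hγ : 0 ≤ γ) (hc : 0 ≤ c) :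
    0 ≤ coeff N Y τ L γ c := by
  unfold coeff; positivity

/-- Using `γ * Lt ≤ 1` and `gap ≥ Y / 2`, the step becomes affine in `c`, with growth rate and
increment both linear in `γ`. The 9 is 1 from `β` plus 8 from the `c`-part of `coeff`. -/
theorem cStep_bounds {N Y τ b : ℕ} {L Lt γ c : ℝ} (hY : 0 < Y) (hb : 0 < b)
    (hL : 0 ≤ L) (hLt : 0 < Lt) (hγ : 0 ≤ γ) (hγ1 : γ * Lt ≤ 1)
    (hgap : (Y : ℝ) / 2 ≤ gap N Y τ Lt γ) (hc : 0 ≤ c) :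
    0 ≤ cStep N Y τ b L Lt γ (Lt * (N : ℝ) ^ 2 / Y) c ∧
    cStep N Y τ b L Lt γ (Lt * (N : ℝ) ^ 2 / Y) c
      ≤ c * (1 + γ * (9 * N ^ 2 * Lt / Y))
        + γ * (8 * N * Lt * (L * Y / (2 * N) + N * L ^ 2 * (τ : ℝ) ^ 2 / (Y * Lt))) := by
  have hY' : (0 : ℝ) < Y := by exact_mod_cast hY
  have hb' : (1 : ℝ) ≤ b := by exact_mod_cast hb
  have hg : 0 < gap N Y τ Lt γ := by linarith
  have h0 := coeff_nonneg (N := N) (Y := Y) (τ := τ) hL hγ hc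
  set K := L * Y / (2 * N) + N * L ^ 2 * (τ : ℝ) ^ 2 / (Y * Lt) with hK
  have hK0 : 0 ≤ K := by positivity
  have h1 : coeff N Y τ L γ c ≤ γ ^ 2 * (c * N / Y + K) := coeff_le hLt hγ1
  have h2 : 4 * Y * N * Lt ^ 2 / (b * gap N Y τ Lt γ) ≤ 8 * N * Lt ^ 2 := by
    rw [div_le_iff₀ (by positivity)]
    have : (Y : ℝ) / 2 ≤ b * gap N Y τ Lt γ := by nlinarith
    calc 4 * Y * N * Lt ^ 2 = 8 * N * Lt ^ 2 * (Y / 2) := by ring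
      _ ≤ _ := by gcongr
  have h3 : coeff N Y τ L γ c * (4 * Y * N * Lt ^ 2 / (b * gap N Y τ Lt γ))
      ≤ γ * (8 * N * Lt) * (c * N / Y + K) := by
    calc _ ≤ γ ^ 2 * (c * N / Y + K) * (8 * N * Lt ^ 2) := by gcongr
      _ = (γ * Lt) * (γ * (8 * N * Lt) * (c * N / Y + K)) := by ring
      _ ≤ 1 * (γ * (8 * N * Lt) * (c * N / Y + K)) := by gcongr
      _ = _ := one_mul _
  unfold cStep
  refine ⟨by positivity, ?_⟩
  calc _ ≤ c * (1 + γ * (Lt * (N : ℝ) ^ 2 / Y)) + γ * (8 * N * Lt) * (c * N / Y + K) := by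
        linarith
    _ = _ := by ring

/-- The constant bounding the sequence `c_t`. -/
noncomputable def cBound (N Y τ : ℕ) (L Lt : ℝ) : ℝ :=
  Y / (5 * (N : ℝ) ^ 2 * Lt)
    * (8 * N * Lt * (L * Y / (2 * N) + N * L ^ 2 * (τ : ℝ) ^ 2 / (Y * Lt))) * Real.exp (9 / 5)

/-- Growth rate and increment are proportional to `γ`, so over `m` steps only `γ * m` matters. Its
bound turns the accumulated growth into `exp (9/5)`, uniformly in `l`, `b`, `m` and `u₀`. -/
theorem c_le_cBound {N Y τ b m : ℕ} {L Lt γ : ℝ} {β c : ℕ → ℝ} (hN : 0 < N) (hY : 0 < Y)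
    (hb : 0 < b) (hL : 0 ≤ L) (hLt : 0 < Lt) (hγ : 0 ≤ γ) (hγ1 : γ * Lt ≤ 1)
    (hγm : γ * m ≤ Y / (5 * (N : ℝ) ^ 2 * Lt))
    (hgap : (Y : ℝ) / 2 ≤ gap N Y τ Lt γ) (hβ : ∀ t < m, β t = Lt * (N : ℝ) ^ 2 / Y)
    (hcm : c m = 0) (hc : ∀ t < m, c t = cStep N Y τ b L Lt γ (β t) (c (t + 1))) :
    ∀ t ≤ m, 0 ≤ c t ∧ c t ≤ cBound N Y τ L Lt := by
  have hN' : (0 : ℝ) < N := by exact_mod_cast hN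
  have hY' : (0 : ℝ) < Y := by exact_mod_cast hY
  set K := L * Y / (2 * N) + N * L ^ 2 * (τ : ℝ) ^ 2 / (Y * Lt) with hK
  have hK0 : 0 ≤ K := by positivity
  have hA : γ * (9 * N ^ 2 * Lt / Y) * m ≤ 9 / 5 := by
    calc _ = γ * m * (9 * N ^ 2 * Lt / Y) := by ring
      _ ≤ Y / (5 * (N : ℝ) ^ 2 * Lt) * (9 * N ^ 2 * Lt / Y) := by gcongr
      _ = _ := by field_simp
  have := backward_recursion_le (c := c) (m := m) (p := γ * (9 * N ^ 2 * Lt / Y))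
    (q := γ * (8 * N * Lt * K)) (by positivity) (by positivity) hA hcm (by
      intro t ht h0
      rw [hc t ht, hβ t ht]
      exact cStep_bounds hY hb hL hLt hγ hγ1 hgap h0)
  intro t ht
  refine ⟨(this t ht).1, (this t ht).2.trans ?_⟩
  unfold cBound
  rw [← hK]
  calc _ = γ * m * (8 * N * Lt * K) * Real.exp (9 / 5) := by ring
    _ ≤ _ := by gcongr

theorem half_le_gap {N Y τ : ℕ} {Lt γ u : ℝ} (hLt : 0 < Lt) (hγ : 0 ≤ γ)
    (hγu : γ * Lt ≤ u) (hu1 : u ≤ 1) (hu : u * (4 * N * (τ : ℝ) ^ 2) ≤ Y) :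
    (Y : ℝ) / 2 ≤ gap N Y τ Lt γ := by
  have h1 : (γ * Lt) ^ 2 ≤ u := by
    have : 0 ≤ γ * Lt := by positivity
    nlinarith
  have h2 := mul_le_mul_of_nonneg_right h1 (by positivity : (0 : ℝ) ≤ 4 * N * (τ : ℝ) ^ 2)
  unfold gap
  nlinarith

/-- The subtracted term is at most `8 * Lh * γ² * (C * N / Y + K)`. Written as `γ / 4` times `32 *
Lh * γ * (C * N / Y + K)`, it is at most `γ / 4` by `γ * Lt ≤ u` and the condition on `u`. -/
theorem quarter_le_Gam {N Y τ : ℕ} {L Lt Lh γ c C u : ℝ} (hY : 0 < Y)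
    (hL : 0 ≤ L) (hLt : 0 < Lt) (hLh : 0 ≤ Lh) (hγ : 0 ≤ γ) (hγu : γ * Lt ≤ u) (hu1 : u ≤ 1)
    (hgap : (Y : ℝ) / 2 ≤ gap N Y τ Lt γ) (hc : 0 ≤ c) (hcC : c ≤ C)
    (hu : u * (32 * Lh * (C * N / Y
      + (L * Y / (2 * N) + N * L ^ 2 * (τ : ℝ) ^ 2 / (Y * Lt)))) ≤ Lt) :
    γ / 4 ≤ Gam N Y τ L Lt Lh γ c := by
  have hY' : (0 : ℝ) < Y := by exact_mod_cast hY
  have hg : 0 < gap N Y τ Lt γ := by linarith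
  set K := L * Y / (2 * N) + N * L ^ 2 * (τ : ℝ) ^ 2 / (Y * Lt) with hK
  have hK0 : 0 ≤ K := by positivity
  have h1 : coeff N Y τ L γ c ≤ γ ^ 2 * (C * N / Y + K) := by
    refine (coeff_le hLt (hγu.trans hu1)).trans ?_
    rw [← hK]
    gcongr
  have h0 := coeff_nonneg (N := N) (Y := Y) (τ := τ) hL hγ hc
  have hC : 0 ≤ C := hc.trans hcC
  have h2 : 4 * Y * Lh / gap N Y τ Lt γ ≤ 8 * Lh := by
    rw [div_le_iff₀ hg]
    calc 4 * Y * Lh = 8 * Lh * (Y / 2) := by ring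
      _ ≤ _ := by gcongr
  have h3 : coeff N Y τ L γ c * (4 * Y * Lh / gap N Y τ Lt γ) ≤ γ / 4 := by
    have h4 : γ * (32 * Lh * (C * N / Y + K)) ≤ 1 := by
      have h5 := mul_le_mul_of_nonneg_right hγu
        (by positivity : (0 : ℝ) ≤ 32 * Lh * (C * N / Y + K))
      have h6 := h5.trans hu
      by_contra! hcon
      nlinarith
    calc _ ≤ γ ^ 2 * (C * N / Y + K) * (8 * Lh) := by gcongr
      _ = γ / 4 * (γ * (32 * Lh * (C * N / Y + K))) := by ring
      _ ≤ γ / 4 * 1 := by gcongr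
      _ = _ := mul_one _
  unfold Gam
  linarith

/-! ### Functions with Lipschitz gradient -/

theorem fderiv_eq_inner_gradient {N : ℕ} {g : Vec N → ℝ} (x h : Vec N) :
    fderiv ℝ g x h = inner ℝ (gradient g x) h := by
  rw [gradient, InnerProductSpace.toDual_symm_apply]

/-- The mean value inequality on the segment gives `L` in place of the sharp `L / 2`; the loss only
affects how small `u₀` must be. -/
theorem abs_sub_sub_inner_gradient_le {N : ℕ} {g : Vec N → ℝ} {L : ℝ} (hL : 0 ≤ L)
    (hg : Differentiable ℝ g)
    (hlip : ∀ x y, ‖gradient g x - gradient g y‖ ≤ L * ‖x - y‖) (x y : Vec N) :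
    |g y - g x - inner ℝ (gradient g x) (y - x)| ≤ L * ‖y - x‖ ^ 2 := by
  have key := (convex_segment x y).norm_image_sub_le_of_norm_fderiv_le' (𝕜 := ℝ) (f := g)
    (φ := fderiv ℝ g x) (C := L * ‖y - x‖) (fun z _ => hg z) (fun z hz => ?_)
    (left_mem_segment ℝ x y) (right_mem_segment ℝ x y)
  · rw [fderiv_eq_inner_gradient, Real.norm_eq_abs] at key
    calc _ ≤ L * ‖y - x‖ * ‖y - x‖ := key
      _ = _ := by ring
  · have h1 : ‖fderiv ℝ g z - fderiv ℝ g x‖ = ‖gradient g z - gradient g x‖ := by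
      rw [gradient, gradient, ← map_sub, LinearIsometryEquiv.norm_map]
    rw [h1]
    refine (hlip z x).trans (mul_le_mul_of_nonneg_left ?_ hL)
    exact norm_sub_le_of_mem_segment hz

theorem partialD_eq_gradient {N : ℕ} {g : Vec N → ℝ} (hg : Differentiable ℝ g) (j : Fin N)
    (x : Vec N) : partialD j g x = gradient g x j := by
  rw [partialD, (hg x).lineDeriv_eq_fderiv, fderiv_eq_inner_gradient, e,
    EuclideanSpace.inner_single_right]
  simp

theorem inner_e {N : ℕ} (v : Vec N) (j : Fin N) : inner ℝ v (e j) = v j := by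
  rw [e, EuclideanSpace.inner_single_right]
  simp

/-- A function with constant gradient is affine on coordinate lines. -/
theorem apply_add_smul_e {N : ℕ} {g : Vec N → ℝ} (hg : Differentiable ℝ g)
    (hlip : ∀ x y, ‖gradient g x - gradient g y‖ ≤ 0 * ‖x - y‖) (j : Fin N) (x : Vec N) (v : ℝ) :
    g (x + v • e j) = g x + v * gradient g x j := by
  have h := abs_sub_sub_inner_gradient_le le_rfl hg hlip x (x + v • e j)
  rw [zero_mul, add_sub_cancel_left, inner_smul_right, inner_e] at h
  linarith [abs_eq_zero.1 (le_antisymm h (abs_nonneg _))]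

theorem diffQuot_eq_gradient {N : ℕ} {μ : Fin N → ℝ} {g : Vec N → ℝ} {L : ℝ}
    (hg : Differentiable ℝ g)
    (hlip : ∀ x y, ‖gradient g x - gradient g y‖ ≤ L * ‖x - y‖)
    (j : Fin N) (hj : L = 0 ∨ μ j = 0) (x : Vec N) : diffQuot μ g j x = gradient g x j := by
  unfold diffQuot
  split_ifs with h
  · exact partialD_eq_gradient hg j x
  · obtain rfl := hj.resolve_right h
    rw [sub_eq_add_neg x, ← neg_smul, apply_add_smul_e hg hlip, apply_add_smul_e hg hlip]
    field_simp
    ring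

/-- For `L = 0` the function is affine along the coordinate line, and the linear part averages to
zero over the symmetric interval. -/
theorem coordSmooth_eq_self {N : ℕ} {μ : Fin N → ℝ} {g : Vec N → ℝ} {L : ℝ}
    (hg : Differentiable ℝ g)
    (hlip : ∀ x y, ‖gradient g x - gradient g y‖ ≤ L * ‖x - y‖)
    (j : Fin N) (hj : L = 0 ∨ μ j = 0) : coordSmooth μ g j = g := by
  ext x
  unfold coordSmooth
  split_ifs with h
  · rfl
  · obtain rfl := hj.resolve_right h
    simp_rw [apply_add_smul_e hg hlip]
    rw [intervalIntegral.integral_add (by simp)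
      (Continuous.intervalIntegrable (by fun_prop) _ _), intervalIntegral.integral_const,
      intervalIntegral.integral_mul_const, integral_id]
    simp only [smul_eq_mul]
    field_simp
    ring

theorem sum_smul_e {N : ℕ} (v : Vec N) : ∑ j, v j • e j = v := by
  ext i
  simp [e, Pi.single_apply]

/-- This transfers the `Lt`-Lipschitz hypothesis from the mixtured gradient to the gradient of the
objective. -/
theorem mixGrad_eq_gradient {N : ℕ} {μ : Fin N → ℝ} {g : Vec N → ℝ} {L : ℝ}
    (hg : Differentiable ℝ g)
    (hlip : ∀ x y, ‖gradient g x - gradient g y‖ ≤ L * ‖x - y‖)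
    (hj : ∀ j, L = 0 ∨ μ j = 0) (x : Vec N) : mixGrad μ g x = gradient g x := by
  unfold mixGrad
  simp_rw [coordSmooth_eq_self hg hlip _ (hj _), partialD_eq_gradient hg]
  exact sum_smul_e _

theorem eq_zero_or_eq_zero_of_smoothingError {N : ℕ} {L : ℝ} {μ : Fin N → ℝ}
    (h : smoothingError L μ = 0) (j : Fin N) : L = 0 ∨ μ j = 0 := by
  have hN : (N : ℝ) ≠ 0 := by
    have := j.pos
    positivity
  rw [smoothingError, div_eq_zero_iff, or_iff_left hN, mul_eq_zero,
    Finset.sum_eq_zero_iff_of_nonneg fun _ _ => sq_nonneg _] at h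
  exact h.imp (fun h => by simpa using h) fun h => by simpa using h j (Finset.mem_univ j)

/-! ### The averaged objective -/

theorem hasGradientAt_avg {N l : ℕ} {f : Fin l → Vec N → ℝ} (hf : ∀ i, Differentiable ℝ (f i))
    (x : Vec N) :
    HasGradientAt (avg f) ((1 / (l : ℝ)) • ∑ i, gradient (f i) x) x := by
  rw [hasGradientAt_iff_hasFDerivAt, map_smul, map_sum]
  exact (HasFDerivAt.fun_sum fun i _ =>
    hasGradientAt_iff_hasFDerivAt.1 (hf i x).hasGradientAt).const_mul _

theorem differentiable_avg {N l : ℕ} {f : Fin l → Vec N → ℝ} (hf : ∀ i, Differentiable ℝ (f i)) :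
    Differentiable ℝ (avg f) := fun x => (hasGradientAt_avg hf x).differentiableAt

theorem gradient_avg {N l : ℕ} {f : Fin l → Vec N → ℝ} (hf : ∀ i, Differentiable ℝ (f i))
    (x : Vec N) : gradient (avg f) x = (1 / (l : ℝ)) • ∑ i, gradient (f i) x :=
  (hasGradientAt_avg hf x).gradient

/-- A mean of vectors of norm at most `C` has norm at most `C`. -/
theorem norm_mean_le {N n : ℕ} {v : Fin n → Vec N} {C : ℝ} (hC : 0 ≤ C) (h : ∀ i, ‖v i‖ ≤ C) :
    ‖(1 / (n : ℝ)) • ∑ i, v i‖ ≤ C := by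
  have h1 : ‖∑ i, v i‖ ≤ n * C := by
    simpa using norm_sum_le_of_le Finset.univ (fun i _ => h i)
  rw [norm_smul, Real.norm_of_nonneg (by positivity)]
  rcases Nat.eq_zero_or_pos n with rfl | hn
  · simpa using hC
  · have : (0 : ℝ) < n := by exact_mod_cast hn
    rw [one_div, inv_mul_le_iff₀ this]
    exact h1

theorem norm_gradient_avg_sub_le {N l : ℕ} {f : Fin l → Vec N → ℝ} {L : ℝ} (hL : 0 ≤ L)
    (hf : ∀ i, Differentiable ℝ (f i))
    (hlip : ∀ i x y, ‖gradient (f i) x - gradient (f i) y‖ ≤ L * ‖x - y‖) (x y : Vec N) :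
    ‖gradient (avg f) x - gradient (avg f) y‖ ≤ L * ‖x - y‖ := by
  rw [gradient_avg hf, gradient_avg hf, ← smul_sub, ← Finset.sum_sub_distrib]
  exact norm_mean_le (by positivity) fun i => hlip i x y

/-! ### The variance-reduced estimate -/

/-- The variance-reduced gradient estimate of the mini-batch `I`, before restriction to a random
set of coordinates. -/
noncomputable def fullEstimate {N l b : ℕ} (f : Fin l → Vec N → ℝ) (I : Fin b → Fin l)
    (xh xs : Vec N) : Vec N :=
  (1 / (b : ℝ)) • ∑ k, (gradient (f (I k)) xh - gradient (f (I k)) xs) + gradient (avg f) xs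

theorem G_eq_restrict {N : ℕ} {μ : Fin N → ℝ} {g : Vec N → ℝ} {L : ℝ}
    (hg : Differentiable ℝ g)
    (hlip : ∀ x y, ‖gradient g x - gradient g y‖ ≤ L * ‖x - y‖)
    (hj : ∀ j, L = 0 ∨ μ j = 0) (Y : ℕ) (J : Finset (Fin N)) (x : Vec N) :
    G μ Y J g x = ((N : ℝ) / Y) • restrict J (gradient g x) := by
  unfold G
  simp_rw [diffQuot_eq_gradient hg hlip _ (hj _)]
  ext i
  simp [e, restrict, Pi.single_apply]

theorem restrict_add {N : ℕ} (A : Finset (Fin N)) (v w : Vec N) :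
    restrict A (v + w) = restrict A v + restrict A w := by
  ext i
  simp only [restrict, PiLp.add_apply]
  split_ifs <;> simp

theorem restrict_smul {N : ℕ} (A : Finset (Fin N)) (r : ℝ) (v : Vec N) :
    restrict A (r • v) = r • restrict A v := by
  ext i
  simp [restrict]

/-- `restrict` as a linear map. -/
noncomputable def restrictL {N : ℕ} (A : Finset (Fin N)) : Vec N →ₗ[ℝ] Vec N where
  toFun := restrict A
  map_add' := restrict_add A
  map_smul' := restrict_smul A

theorem norm_restrict_le {N : ℕ} (A : Finset (Fin N)) (v : Vec N) : ‖restrict A v‖ ≤ ‖v‖ := by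
  rw [EuclideanSpace.norm_eq, EuclideanSpace.norm_eq]
  refine Real.sqrt_le_sqrt (Finset.sum_le_sum fun i _ => ?_)
  simp only [restrict]
  split_ifs <;> simp [sq_nonneg]

/-- All operations are linear, so the choice of coordinates factors out of the mini-batch estimate.
This separates the two sources of randomness. -/
theorem estimate_eq_restrict {N l b : ℕ} {μ : Fin N → ℝ} {f : Fin l → Vec N → ℝ} {L : ℝ}
    (hf : ∀ i, Differentiable ℝ (f i))
    (hlip : ∀ i x y, ‖gradient (f i) x - gradient (f i) y‖ ≤ L * ‖x - y‖)
    (hj : ∀ j, L = 0 ∨ μ j = 0) (Y : ℕ) (I : Fin b → Fin l) (J : Finset (Fin N))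
    (xh xs : Vec N) :
    estimate μ Y f I J xh xs = ((N : ℝ) / Y) • restrict J (fullEstimate f I xh xs) := by
  have h : ∀ v : Vec N, restrict J v = restrictL J v := fun _ => rfl
  unfold estimate fullEstimate
  simp_rw [G_eq_restrict (hf _) (hlip _) hj, gradient_avg hf, h]
  simp only [map_add, map_smul, map_sum, map_sub, smul_add, Finset.sum_sub_distrib, smul_sub,
    ← Finset.smul_sum]
  simp only [smul_comm ((N : ℝ) / Y)]

/-- The bound holds for every mini-batch, which is what lets the growth of the updates be controlled
path by path. -/
theorem norm_fullEstimate_le {N l b : ℕ} {f : Fin l → Vec N → ℝ} {L : ℝ} (hL : 0 ≤ L)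
    (hlip : ∀ i x y, ‖gradient (f i) x - gradient (f i) y‖ ≤ L * ‖x - y‖) (I : Fin b → Fin l)
    (xh xs : Vec N) :
    ‖fullEstimate f I xh xs‖ ≤ L * ‖xh - xs‖ + ‖gradient (avg f) xs‖ :=
  (norm_add_le _ _).trans
    (add_le_add_left (norm_mean_le (by positivity) fun k => hlip (I k) xh xs) _)

/-! ### Pathwise estimates for an inner loop -/

section InnerLoop

variable {N l b : ℕ} (μ : Fin N → ℝ) (Y : ℕ) (f : Fin l → Vec N → ℝ) (γ : ℝ) (p : Path N l b)
  (s : ℕ) (xs : Vec N)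

/-- The point that is read in inner iteration `t`. -/
noncomputable def readAt (t : ℕ) : Vec N :=
  readPoint γ (p.pending s t) (p.missed s t) (innerLoop μ Y f γ p s xs t)

/-- The estimate that is computed in inner iteration `t`. -/
noncomputable def updateAt (t : ℕ) : Vec N :=
  estimate μ Y f (p.batch s t) (p.coords s t) (readAt μ Y f γ p s xs t) xs

theorem innerLoop_succ_x (t : ℕ) :
    (innerLoop μ Y f γ p s xs (t + 1)).x
      = (innerLoop μ Y f γ p s xs t).x - γ • updateAt μ Y f γ p s xs t := rfl

theorem innerLoop_upd {t i : ℕ} (hi : i < t) :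
    (innerLoop μ Y f γ p s xs t).upd i = updateAt μ Y f γ p s xs i := by
  induction t with
  | zero => omega
  | succ t ih =>
    change Function.update (innerLoop μ Y f γ p s xs t).upd t (updateAt μ Y f γ p s xs t) i = _
    rcases eq_or_ne i t with rfl | h
    · rw [Function.update_self]
    · rw [Function.update_of_ne h, ih (by omega)]

variable {γ}

theorem norm_innerLoop_x_sub_le (hγ : 0 ≤ γ) (t : ℕ) :
    ‖(innerLoop μ Y f γ p s xs t).x - xs‖
      ≤ γ * ∑ i ∈ Finset.range t, ‖updateAt μ Y f γ p s xs i‖ := by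
  induction t with
  | zero => simp [innerLoop]
  | succ t ih =>
    rw [innerLoop_succ_x, Finset.sum_range_succ, mul_add, sub_right_comm]
    refine (norm_sub_le _ _).trans (add_le_add ih ?_)
    rw [norm_smul, Real.norm_of_nonneg hγ]

theorem norm_readAt_sub_le (hγ : 0 ≤ γ) {t : ℕ} (hK : ∀ i ∈ p.pending s t, i < t) :
    ‖readAt μ Y f γ p s xs t - (innerLoop μ Y f γ p s xs t).x‖
      ≤ γ * ∑ i ∈ p.pending s t, ‖updateAt μ Y f γ p s xs i‖ := by
  rw [readAt, readPoint, add_sub_cancel_left, norm_smul, Real.norm_of_nonneg hγ]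
  refine mul_le_mul_of_nonneg_left (norm_sum_le_of_le _ fun i hi => ?_) hγ
  rw [innerLoop_upd _ _ _ _ _ _ _ (hK i hi)]
  exact norm_restrict_le _ _

end InnerLoop

/-- The constant bounding `∑ ‖v̂‖²` by `∑ ‖∇f‖²` along an inner loop. -/
noncomputable def updBound (N Y : ℕ) (L Lt : ℝ) : ℝ :=
  2 * ((N : ℝ) / Y) ^ 2 *
    (1 + ((N : ℝ) / Y * (Lt + 2 * L) * (Y / (5 * (N : ℝ) ^ 2 * Lt))) ^ 2
      * Real.exp ((N : ℝ) / Y * (Lt + 2 * L) * (Y / (5 * (N : ℝ) ^ 2 * Lt))) ^ 2)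

theorem updBound_nonneg (N Y : ℕ) (L Lt : ℝ) : 0 ≤ updBound N Y L Lt := by
  unfold updBound; positivity

section InnerLoop

variable {N l b : ℕ} {μ : Fin N → ℝ} {Y m τ : ℕ} {f : Fin l → Vec N → ℝ} {γ L Lt : ℝ}
  {p : Path N l b} {s : ℕ}

/-- Both the drift from the snapshot and the read error are at most `γ` times the sum of all earlier
update norms. The resulting inequality has the Grönwall form. -/
theorem norm_updateAt_le (hL : 0 ≤ L) (hLt : 0 < Lt) (hf : ∀ i, Differentiable ℝ (f i))
    (hlip : ∀ i x y, ‖gradient (f i) x - gradient (f i) y‖ ≤ L * ‖x - y‖)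
    (hj : ∀ j, L = 0 ∨ μ j = 0)
    (hF : ∀ x y, ‖gradient (avg f) x - gradient (avg f) y‖ ≤ Lt * ‖x - y‖)
    (hγ : 0 ≤ γ) (xs : Vec N) {t : ℕ} (hK : ∀ i ∈ p.pending s t, i < t) :
    ‖updateAt μ Y f γ p s xs t‖
      ≤ (N : ℝ) / Y * ‖gradient (avg f) (innerLoop μ Y f γ p s xs t).x‖
        + γ * ((N : ℝ) / Y * (Lt + 2 * L))
          * ∑ i ∈ Finset.range t, ‖updateAt μ Y f γ p s xs i‖ := by
  set x := (innerLoop μ Y f γ p s xs t).x with hx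
  set xh := readAt μ Y f γ p s xs t with hxh
  set W := ∑ i ∈ Finset.range t, ‖updateAt μ Y f γ p s xs i‖ with hW
  have h1 : ‖x - xs‖ ≤ γ * W := norm_innerLoop_x_sub_le μ Y f p s xs hγ t
  have h2 : ‖xh - x‖ ≤ γ * W := by
    refine (norm_readAt_sub_le μ Y f p s xs hγ hK).trans (mul_le_mul_of_nonneg_left ?_ hγ)
    exact Finset.sum_le_sum_of_subset_of_nonneg (fun i hi => Finset.mem_range.2 (hK i hi))
      fun _ _ _ => norm_nonneg _
  have h3 : ‖xh - xs‖ ≤ 2 * (γ * W) := by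
    have := norm_add_le (xh - x) (x - xs)
    rw [sub_add_sub_cancel] at this
    linarith
  have h4 : ‖gradient (avg f) xs‖ ≤ ‖gradient (avg f) x‖ + Lt * (γ * W) := by
    have := hF xs x
    rw [norm_sub_rev xs x] at this
    have h5 := norm_le_norm_add_norm_sub (gradient (avg f) x) (gradient (avg f) xs)
    rw [norm_sub_rev] at h5
    have := mul_le_mul_of_nonneg_left h1 hLt.le
    linarith
  rw [updateAt, estimate_eq_restrict hf hlip hj, norm_smul, Real.norm_of_nonneg (by positivity)]
  calc _ ≤ (N : ℝ) / Y * (L * (2 * (γ * W)) + (‖gradient (avg f) x‖ + Lt * (γ * W))) := by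
        refine mul_le_mul_of_nonneg_left ?_ (by positivity)
        refine (norm_restrict_le _ _).trans ((norm_fullEstimate_le hL hlip _ _ _).trans ?_)
        exact add_le_add (mul_le_mul_of_nonneg_left h3 hL) h4
    _ = _ := by ring

theorem sum_norm_updateAt_sq_le (hL : 0 ≤ L) (hLt : 0 < Lt)
    (hf : ∀ i, Differentiable ℝ (f i))
    (hlip : ∀ i x y, ‖gradient (f i) x - gradient (f i) y‖ ≤ L * ‖x - y‖)
    (hj : ∀ j, L = 0 ∨ μ j = 0)
    (hF : ∀ x y, ‖gradient (avg f) x - gradient (avg f) y‖ ≤ Lt * ‖x - y‖)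
    (hγ : 0 ≤ γ) (hγm : γ * m ≤ Y / (5 * (N : ℝ) ^ 2 * Lt)) (xs : Vec N)
    (hK : ∀ t < m, ∀ i ∈ p.pending s t, i < t) :
    ∑ t ∈ Finset.range m, ‖updateAt μ Y f γ p s xs t‖ ^ 2
      ≤ updBound N Y L Lt
        * ∑ t ∈ Finset.range m, ‖gradient (avg f) (innerLoop μ Y f γ p s xs t).x‖ ^ 2 := by
  refine sum_sq_le_of_le_add_sum (a := γ * ((N : ℝ) / Y * (Lt + 2 * L))) (by positivity)
    (by positivity) ?_ (fun _ => norm_nonneg _) (fun _ => norm_nonneg _) fun t ht =>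
      norm_updateAt_le hL hLt hf hlip hj hF hγ xs (hK t ht)
  calc _ = (N : ℝ) / Y * (Lt + 2 * L) * (γ * m) := by ring
    _ ≤ _ := by gcongr

/-- Pathwise descent along an inner loop: up to a term of mean zero, the objective decreases by
`γ / 4` times the sum of the squared gradients. -/
theorem avg_innerLoop_le (hL : 0 ≤ L) (hLt : 0 < Lt) (hf : ∀ i, Differentiable ℝ (f i))
    (hlip : ∀ i x y, ‖gradient (f i) x - gradient (f i) y‖ ≤ L * ‖x - y‖)
    (hj : ∀ j, L = 0 ∨ μ j = 0)
    (hF : ∀ x y, ‖gradient (avg f) x - gradient (avg f) y‖ ≤ Lt * ‖x - y‖)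
    (hγ : 0 ≤ γ) (hγm : γ * m ≤ Y / (5 * (N : ℝ) ^ 2 * Lt)) {u : ℝ} (hγu : γ * Lt ≤ u)
    (hu1 : u ≤ 1) (hu : u * (4 * (((τ : ℝ) ^ 2 + 1) * updBound N Y L Lt)) ≤ 1) (xs : Vec N)
    (hK : ∀ t < m, ∀ i ∈ p.pending s t, i < t ∧ t - i ≤ τ) :
    avg f (innerLoop μ Y f γ p s xs m).x
      ≤ avg f xs
        - γ * ∑ t ∈ Finset.range m, inner ℝ (gradient (avg f) (innerLoop μ Y f γ p s xs t).x)
            (updateAt μ Y f γ p s xs t - gradient (avg f) (readAt μ Y f γ p s xs t))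
        - γ / 4 * ∑ t ∈ Finset.range m,
            ‖gradient (avg f) (innerLoop μ Y f γ p s xs t).x‖ ^ 2 := by
  have hV := sum_norm_updateAt_sq_le hL hLt hf hlip hj hF hγ hγm xs fun t ht i hi =>
    (hK t ht i hi).1
  have hwin := sum_sq_window_le (w := fun t => ‖updateAt μ Y f γ p s xs t‖) hK
  set x := fun t => (innerLoop μ Y f γ p s xs t).x with hx
  set xh := readAt μ Y f γ p s xs with hxh
  set v := updateAt μ Y f γ p s xs with hv
  set C := updBound N Y L Lt
  have hC : 0 ≤ C := updBound_nonneg _ _ _ _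
  -- Descent inequality for the `Lt`-smooth objective.
  have hstep : ∀ t, avg f (x (t + 1))
      ≤ avg f (x t) - γ * inner ℝ (gradient (avg f) (x t)) (v t) + Lt * γ ^ 2 * ‖v t‖ ^ 2 := by
    intro t
    have h := (abs_le.1 (abs_sub_sub_inner_gradient_le hLt.le (differentiable_avg hf) hF (x t)
      (x (t + 1)))).2
    have e : x (t + 1) - x t = -(γ • v t) := by
      simp only [hx, innerLoop_succ_x, hv]
      abel
    rw [e, inner_neg_right, inner_smul_right, norm_neg, norm_smul, Real.norm_of_nonneg hγ] at h
    nlinarith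
  have htel : ∀ n, avg f (x n) ≤ avg f xs
      - γ * ∑ t ∈ Finset.range n, inner ℝ (gradient (avg f) (x t)) (v t)
      + Lt * γ ^ 2 * ∑ t ∈ Finset.range n, ‖v t‖ ^ 2 := by
    intro n
    induction n with
    | zero => simp [hx, innerLoop]
    | succ n ih =>
      rw [Finset.sum_range_succ, Finset.sum_range_succ]
      have := hstep n
      linarith
  -- Polarization: `2⟨a, b⟩ = ‖a‖² + ‖b‖² - ‖a - b‖²` with `‖b‖²` dropped. The distance between the
  -- two gradients is bounded by the read error.
  have hdev : ∀ t ∈ Finset.range m,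
      1 / 2 * ‖gradient (avg f) (x t)‖ ^ 2
        - Lt ^ 2 * γ ^ 2 / 2 * (∑ i ∈ p.pending s t, ‖v i‖) ^ 2
      ≤ inner ℝ (gradient (avg f) (x t)) (gradient (avg f) (xh t)) := by
    intro t ht
    have h1 := norm_readAt_sub_le μ Y f p s xs hγ fun i hi =>
      (hK t (Finset.mem_range.1 ht) i hi).1
    have h2 : ‖gradient (avg f) (x t) - gradient (avg f) (xh t)‖
        ≤ Lt * (γ * ∑ i ∈ p.pending s t, ‖v i‖) := by
      refine (hF _ _).trans (mul_le_mul_of_nonneg_left ?_ hLt.le)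
      rw [norm_sub_rev]
      exact h1
    have h3 := pow_le_pow_left₀ (norm_nonneg _) h2 2
    have h4 := norm_sub_sq_real (gradient (avg f) (x t)) (gradient (avg f) (xh t))
    nlinarith [sq_nonneg ‖gradient (avg f) (xh t)‖]
  have hdevs := Finset.sum_le_sum hdev
  rw [Finset.sum_sub_distrib, ← Finset.mul_sum, ← Finset.mul_sum] at hdevs
  have hfin := htel m
  simp only [inner_sub_right, Finset.sum_sub_distrib]
  set Q := ∑ t ∈ Finset.range m, ‖gradient (avg f) (x t)‖ ^ 2
  set V := ∑ t ∈ Finset.range m, ‖v t‖ ^ 2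
  set A := ∑ t ∈ Finset.range m, inner ℝ (gradient (avg f) (x t)) (v t)
  set B := ∑ t ∈ Finset.range m, inner ℝ (gradient (avg f) (x t)) (gradient (avg f) (xh t))
  set D := ∑ t ∈ Finset.range m, (∑ i ∈ p.pending s t, ‖v i‖) ^ 2
  have hQ : 0 ≤ Q := Finset.sum_nonneg fun _ _ => sq_nonneg _
  have hu0 : 0 ≤ u := le_trans (by positivity) hγu
  have h2 : (γ * Lt) ^ 2 ≤ u := by
    have : 0 ≤ γ * Lt := by positivity
    nlinarith
  -- Delay error and second-order term together use up half of the main term `Q / 2`.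
  have h5 : Lt ^ 2 * γ ^ 2 / 2 * D + Lt * γ * V ≤ 1 / 4 * Q := by
    calc _ = (γ * Lt) ^ 2 / 2 * D + (γ * Lt) * V := by ring
      _ ≤ u / 2 * ((τ : ℝ) ^ 2 * (C * Q)) + u * (C * Q) := by
        have hD : D ≤ (τ : ℝ) ^ 2 * (C * Q) :=
          hwin.trans (mul_le_mul_of_nonneg_left hV (by positivity))
        have hD0 : 0 ≤ D := Finset.sum_nonneg fun _ _ => sq_nonneg _
        have hV0 : 0 ≤ V := Finset.sum_nonneg fun _ _ => sq_nonneg _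
        gcongr
      _ ≤ u * ((τ : ℝ) ^ 2 * (C * Q)) + u * (C * Q) := by
        have : 0 ≤ u * ((τ : ℝ) ^ 2 * (C * Q)) := by positivity
        linarith
      _ = u * (4 * (((τ : ℝ) ^ 2 + 1) * C)) * (1 / 4 * Q) := by ring
      _ ≤ 1 * (1 / 4 * Q) := by gcongr
      _ = _ := one_mul _
  have h6 := mul_le_mul_of_nonneg_left h5 hγ
  have h7 := mul_le_mul_of_nonneg_left hdevs hγ
  linarith

end InnerLoop

/-! ### Simple random variables -/

/-- `X` takes finitely many values, each of them on an `m`-measurable set. -/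
def IsSimple {Ω A : Type*} (m : MeasurableSpace Ω) (X : Ω → A) : Prop :=
  (Set.range X).Finite ∧ ∀ a, MeasurableSet[m] (X ⁻¹' {a})

namespace IsSimple

variable {Ω A B C D : Type*} {m m' : MeasurableSpace Ω}

theorem const (a : A) : IsSimple m fun _ : Ω => a :=
  ⟨Set.finite_range_const, fun _ => MeasurableSet.const _⟩

theorem mono {X : Ω → A} (hX : IsSimple m X) (h : m ≤ m') : IsSimple m' X :=
  ⟨hX.1, fun a => h _ (hX.2 a)⟩

theorem of_finite [Finite A] {X : Ω → A} (h : ∀ a, MeasurableSet[m] {ω | X ω = a}) :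
    IsSimple m X := ⟨Set.toFinite _, h⟩

/-- `F` is arbitrary: a level set of the composite is a finite union of intersections of level sets.
Thus no σ-algebra on states or read points is needed. -/
theorem comp₂ {X : Ω → A} {Y : Ω → B} (hX : IsSimple m X) (hY : IsSimple m Y) (F : A → B → C) :
    IsSimple m fun ω => F (X ω) (Y ω) := by
  refine ⟨(hX.1.image2 F hY.1).subset ?_, fun c => ?_⟩
  · rintro _ ⟨ω, rfl⟩
    exact Set.mem_image2_of_mem ⟨ω, rfl⟩ ⟨ω, rfl⟩
  · have : (fun ω => F (X ω) (Y ω)) ⁻¹' {c}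
        = ⋃ q ∈ {q ∈ Set.range X ×ˢ Set.range Y | F q.1 q.2 = c}, X ⁻¹' {q.1} ∩ Y ⁻¹' {q.2} := by
      ext ω
      simp only [Set.mem_preimage, Set.mem_singleton_iff, Set.mem_iUnion, Set.mem_inter_iff,
        Set.mem_ofPred_eq, Set.mem_prod, exists_prop]
      constructor
      · exact fun h => ⟨(X ω, Y ω), ⟨⟨⟨ω, rfl⟩, ⟨ω, rfl⟩⟩, h⟩, rfl, rfl⟩
      · rintro ⟨q, ⟨-, h⟩, h1, h2⟩
        rw [h1, h2, h]
    rw [this]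
    exact MeasurableSet.biUnion (((hX.1.prod hY.1).subset (Set.sep_subset _ _)).countable)
      fun q _ => (hX.2 _).inter (hY.2 _)

theorem comp {X : Ω → A} (hX : IsSimple m X) (F : A → B) : IsSimple m fun ω => F (X ω) :=
  hX.comp₂ hX fun a _ => F a

theorem comp₃ {X : Ω → A} {Y : Ω → B} {Z : Ω → C} (hX : IsSimple m X) (hY : IsSimple m Y)
    (hZ : IsSimple m Z) (F : A → B → C → D) : IsSimple m fun ω => F (X ω) (Y ω) (Z ω) :=
  (hX.comp₂ (hY.comp₂ hZ Prod.mk)) fun a q => F a q.1 q.2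

theorem sum [AddCommMonoid A] {ι : Type*} {X : ι → Ω → A} (s : Finset ι)
    (hX : ∀ i ∈ s, IsSimple m (X i)) : IsSimple m fun ω => ∑ i ∈ s, X i ω := by
  classical
  induction s using Finset.induction_on with
  | empty => simpa using const 0
  | insert i s hi ih =>
    simp_rw [Finset.sum_insert hi]
    exact (hX i (Finset.mem_insert_self i s)).comp₂
      (ih fun j hj => hX j (Finset.mem_insert_of_mem hj)) (· + ·)

theorem measurable {X : Ω → ℝ} (hX : IsSimple m X) : Measurable[m] X := fun s _ => by
  have := (hX.comp (· ∈ s)).2 True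
  convert this using 1
  ext ω
  simp

theorem integrable {mΩ : MeasurableSpace Ω} {P : Measure Ω} [IsFiniteMeasure P] {X : Ω → ℝ}
    (hX : IsSimple mΩ X) : Integrable X P := by
  obtain ⟨C, hC⟩ := (hX.1.image norm).bddAbove
  exact Integrable.of_bound hX.measurable.aestronglyMeasurable C
    (.of_forall fun ω => hC ⟨_, ⟨ω, rfl⟩, rfl⟩)

end IsSimple

/-- If `E` is independent of `m`, integrals over `E` of `m`-measurable functions factor. -/
theorem setIntegral_eq_mul_integral {Ω : Type*} {m mΩ : MeasurableSpace Ω} {P : Measure Ω}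
    [IsFiniteMeasure P] (hm : m ≤ mΩ) {E : Set Ω} {q : ℝ} (hq : 0 ≤ q)
    (hE : ∀ H, MeasurableSet[m] H → P.real (H ∩ E) = q * P.real H) {X : Ω → ℝ}
    (hX : IsSimple m X) : ∫ ω in E, X ω ∂P = q * ∫ ω, X ω ∂P := by
  have hsm : StronglyMeasurable[m] X := hX.measurable.stronglyMeasurable
  have h : (P.restrict E).trim hm = ENNReal.ofReal q • P.trim hm := by
    refine @Measure.ext _ m _ _ fun H hH => ?_
    rw [trim_measurableSet_eq hm hH, Measure.smul_apply, trim_measurableSet_eq hm hH,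
      Measure.restrict_apply (hm _ hH), smul_eq_mul, ← ofReal_measureReal (μ := P) (s := H ∩ E),
      hE H hH, ENNReal.ofReal_mul hq, ofReal_measureReal]
  rw [integral_trim hm hsm, h, integral_smul_measure, ENNReal.toReal_ofReal hq, smul_eq_mul,
    ← integral_trim hm hsm]

/-- If `K` is uniform on `D` given the history `m` and `φ z` sums to zero over `D` for all `z`, then
`φ Z K` has mean zero for `m`-measurable `Z`. -/
theorem integral_eq_zero_of_uniform {Ω A κ : Type*} {m mΩ : MeasurableSpace Ω} {P : Measure Ω}
    [IsProbabilityMeasure P] (hm : m ≤ mΩ) {Z : Ω → A} (hZ : IsSimple m Z) {K : Ω → κ}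
    {D : Finset κ} (hD : D.Nonempty) (hK : ∀ k, MeasurableSet {ω | K ω = k})
    (hunif : ∀ H, MeasurableSet[m] H → ∀ k ∈ D,
      P.real (H ∩ {ω | K ω = k}) = 1 / (D.card : ℝ) * P.real H)
    (φ : A → κ → ℝ) (hφ : ∀ z, ∑ k ∈ D, φ z k = 0) : ∫ ω, φ (Z ω) (K ω) ∂P = 0 := by
  classical
  have hcard : (0 : ℝ) < D.card := by exact_mod_cast hD.card_pos
  have hUnion : {ω | K ω ∈ D} = ⋃ k ∈ D, {ω | K ω = k} := by
    ext ω; simp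
  have hmeas : MeasurableSet {ω | K ω ∈ D} := by
    rw [hUnion]
    exact D.measurableSet_biUnion fun k _ => hK k
  -- Uniformity is assumed only for values in `D`; their probabilities already add up to 1.
  have hmem : ∀ᵐ ω ∂P, K ω ∈ D := by
    have h1 : P.real {ω | K ω ∈ D} = 1 := by
      rw [hUnion, measureReal_biUnion_finset (fun i _ j _ hij => ?_) fun k _ => hK k]
      · have : ∀ k ∈ D, P.real {ω | K ω = k} = 1 / (D.card : ℝ) := fun k hk => by
          simpa using hunif Set.univ MeasurableSet.univ k hk
        rw [Finset.sum_congr rfl this]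
        simp [hcard.ne']
      · refine Set.disjoint_left.2 fun ω (h1 : K ω = i) (h2 : K ω = j) => hij (h1 ▸ h2)
    have h2 : P {ω | K ω ∈ D} = 1 := by
      rw [← ofReal_measureReal, h1, ENNReal.ofReal_one]
    exact (prob_compl_eq_zero_iff hmeas).2 h2
  have hsum : (fun ω => φ (Z ω) (K ω))
      =ᵐ[P] fun ω => ∑ k ∈ D, {ω | K ω = k}.indicator (fun ω => φ (Z ω) k) ω := by
    filter_upwards [hmem] with ω hω
    simp only [Set.indicator_apply, Set.mem_ofPred_eq]
    rw [Finset.sum_ite_eq, if_pos hω]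
  have hint : ∀ k, Integrable (fun ω => φ (Z ω) k) P := fun k =>
    ((hZ.comp fun z => φ z k).mono hm).integrable
  rw [integral_congr_ae hsum, integral_finsetSum _ fun k _ => (hint k).indicator (hK k)]
  calc _ = ∑ k ∈ D, 1 / (D.card : ℝ) * ∫ ω, φ (Z ω) k ∂P :=
        Finset.sum_congr rfl fun k hk => by
          rw [integral_indicator (hK k)]
          exact setIntegral_eq_mul_integral hm (by positivity) (fun H hH => hunif H hH k hk)
            (hZ.comp fun z => φ z k)
    _ = 1 / (D.card : ℝ) * ∫ ω, ∑ k ∈ D, φ (Z ω) k ∂P := by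
        rw [integral_finsetSum _ fun k _ => hint k, Finset.mul_sum]
    _ = 0 := by simp [hφ]

/-! ### Uniform draws -/

theorem batches_nonempty {mode : Sampling} {b l : ℕ} (hl : 0 < l) (hb : b ≤ l) :
    (batches mode b l).Nonempty := by
  cases mode with
  | withReplacement => exact ⟨fun _ => ⟨0, hl⟩, Finset.mem_univ _⟩
  | withoutReplacement =>
    exact ⟨Fin.castLE hb, Finset.mem_filter.2 ⟨Finset.mem_univ _, Fin.castLE_injective hb⟩⟩

/-- The set of mini-batches is invariant under permutations of the indices. -/
theorem sum_batches_perm {M : Type*} [AddCommMonoid M] {mode : Sampling} {b l : ℕ}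
    (σ : Equiv.Perm (Fin l)) (F : (Fin b → Fin l) → M) :
    ∑ I ∈ batches mode b l, F (σ ∘ I) = ∑ I ∈ batches mode b l, F I := by
  refine Finset.sum_equiv (Equiv.arrowCongr (Equiv.refl _) σ) (fun I => ?_) fun I _ => rfl
  cases mode with
  | withReplacement => simp [batches]
  | withoutReplacement =>
    simp only [batches, Finset.mem_filter, Finset.mem_univ, true_and]
    exact (σ.injective.of_comp_iff I).symm

/-- Each member of a random mini-batch is uniformly distributed. -/
theorem sum_batches_apply {V : Type*} [AddCommGroup V] [Module ℝ V] {mode : Sampling} {b l : ℕ}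
    (k : Fin b) (h : Fin l → V) :
    ∑ I ∈ batches mode b l, h (I k)
      = ((batches mode b l).card : ℝ) • ((1 / (l : ℝ)) • ∑ i, h i) := by
  rcases Nat.eq_zero_or_pos l with rfl | hl
  · rw [Finset.sum_eq_zero fun I _ => (I k).elim0]
    simp
  have : NeZero l := ⟨hl.ne'⟩
  have hl' : (l : ℝ) ≠ 0 := by positivity
  have key : (l : ℝ) • ∑ I ∈ batches mode b l, h (I k)
      = ((batches mode b l).card : ℝ) • ∑ i, h i := by
    -- Average over the cyclic shifts of `Fin l`: they preserve the set of mini-batches, while for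
    -- fixed `I` the index `a + I k` runs through all of `Fin l`.
    calc (l : ℝ) • ∑ I ∈ batches mode b l, h (I k)
        = ∑ a : Fin l, ∑ I ∈ batches mode b l, h (a + I k) := by
          have e : ∀ a : Fin l, ∑ I ∈ batches mode b l, h (a + I k)
              = ∑ I ∈ batches mode b l, h (I k) := fun a =>
            sum_batches_perm (Equiv.addLeft a) fun I : Fin b → Fin l => h (I k)
          simp [e, Nat.cast_smul_eq_nsmul]
      _ = ∑ I ∈ batches mode b l, ∑ i, h i := by
          rw [Finset.sum_comm]
          exact Finset.sum_congr rfl fun I _ => Equiv.sum_comp (Equiv.addRight (I k)) h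
      _ = _ := by simp [Nat.cast_smul_eq_nsmul]
  rw [smul_comm, ← key, smul_smul, one_div_mul_cancel hl', one_smul]

/-- By uniformity of each member, the snapshot part of the batch averages to `∇f(xs)` and cancels
the correction term. -/
theorem sum_batches_fullEstimate {N l b : ℕ} {mode : Sampling} {f : Fin l → Vec N → ℝ}
    (hb : 0 < b) (hf : ∀ i, Differentiable ℝ (f i)) (xh xs : Vec N) :
    ∑ I ∈ batches mode b l, fullEstimate f I xh xs
      = ((batches mode b l).card : ℝ) • gradient (avg f) xh := by
  have hb' : (b : ℝ) ≠ 0 := by positivity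
  unfold fullEstimate
  rw [Finset.sum_add_distrib, ← Finset.smul_sum, Finset.sum_comm,
    Finset.sum_congr rfl fun k _ => sum_batches_apply k fun i =>
      gradient (f i) xh - gradient (f i) xs,
    Finset.sum_const, Finset.sum_const, Finset.card_univ, Fintype.card_fin,
    ← Nat.cast_smul_eq_nsmul ℝ, ← Nat.cast_smul_eq_nsmul ℝ, smul_smul, one_div_mul_cancel hb',
    one_smul, Finset.sum_sub_distrib, smul_sub, ← gradient_avg hf, ← gradient_avg hf, ← smul_add,
    sub_add_cancel]

theorem card_powersetCard_filter_mem {N Y : ℕ} (hY : 0 < Y) (j : Fin N) :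
    ((Finset.powersetCard Y (Finset.univ : Finset (Fin N))).filter (j ∈ ·)).card
      = (N - 1).choose (Y - 1) := by
  classical
  have : (Finset.powersetCard Y (Finset.univ : Finset (Fin N))).filter (j ∈ ·)
      = (Finset.powersetCard (Y - 1) (Finset.univ.erase j)).image (insert j) := by
    ext J
    simp only [Finset.mem_filter, Finset.mem_powersetCard, Finset.mem_image, Finset.subset_univ,
      true_and]
    constructor
    · rintro ⟨h1, h2⟩
      exact ⟨J.erase j, ⟨Finset.erase_subset_erase _ (Finset.subset_univ _),
        by rw [Finset.card_erase_of_mem h2, h1]⟩, Finset.insert_erase h2⟩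
    · rintro ⟨T, ⟨h1, h2⟩, rfl⟩
      have hj : j ∉ T := fun h => (Finset.mem_erase.1 (h1 h)).1 rfl
      exact ⟨by rw [Finset.card_insert_of_notMem hj, h2]; omega, Finset.mem_insert_self _ _⟩
  rw [this, Finset.card_image_of_injOn, Finset.card_powersetCard,
    Finset.card_erase_of_mem (Finset.mem_univ j), Finset.card_univ, Fintype.card_fin]
  intro T hT T' hT' h
  have hj : ∀ T ∈ Finset.powersetCard (Y - 1) ((Finset.univ : Finset (Fin N)).erase j), j ∉ T :=
    fun T hT h => (Finset.mem_erase.1 ((Finset.mem_powersetCard.1 hT).1 h)).1 rfl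
  rw [← Finset.erase_insert (hj T hT), ← Finset.erase_insert (hj T' hT')]
  exact congrArg (Finset.erase · j) h

/-- A coordinate lies in a fraction `Y / N` of the `Y`-element sets, which the factor `N / Y`
compensates. -/
theorem sum_powersetCard_restrict {N Y : ℕ} (hY : 0 < Y) (hYN : Y ≤ N) (v : Vec N) :
    ∑ J ∈ Finset.powersetCard Y (Finset.univ : Finset (Fin N)), ((N : ℝ) / Y) • restrict J v
      = (N.choose Y : ℝ) • v := by
  ext j
  simp only [WithLp.ofLp_sum, Finset.sum_apply, PiLp.smul_apply, smul_eq_mul, restrict]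
  rw [← Finset.mul_sum, ← Finset.sum_filter, Finset.sum_const, card_powersetCard_filter_mem hY,
    nsmul_eq_mul, ← mul_assoc]
  congr 1
  have hY' : (Y : ℝ) ≠ 0 := by positivity
  have h := Nat.add_one_mul_choose_eq (N - 1) (Y - 1)
  rw [Nat.sub_add_cancel hY, Nat.sub_add_cancel (hY.trans_le hYN)] at h
  have h' : (N : ℝ) * ((N - 1).choose (Y - 1) : ℝ) = (N.choose Y : ℝ) * Y := by exact_mod_cast h
  rw [div_mul_eq_mul_div, h', mul_div_cancel_right₀ _ hY']

/-! ### The random run -/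

section Run

variable {Ω : Type*} {mΩ : MeasurableSpace Ω} {P : Measure Ω} {ℱ : Filtration ℕ mΩ}
  {N l b : ℕ} {mode : Sampling} {Y τ S m : ℕ} {R : Ω → Path N l b}

/-- `Finset ℕ` is infinite; the delay condition confines the values to subsets of `range t`. -/
theorem isSimple_pending (hR : IsAsyncRun P ℱ mode Y τ S m R) {s t : ℕ} (hs : s < S)
    (ht : t < m) : IsSimple (ℱ (s * m + t)) fun ω => (R ω).pending s t := by
  refine ⟨(Finset.range t).powerset.finite_toSet.subset ?_, hR.pending_meas s hs t ht⟩
  rintro _ ⟨ω, rfl⟩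
  exact Finset.mem_coe.2 (Finset.mem_powerset.2 fun i hi =>
    Finset.mem_range.2 (hR.delay ω s hs t ht i hi).1)

theorem isSimple_readAt (hR : IsAsyncRun P ℱ mode Y τ S m R) (μ : Fin N → ℝ)
    (f : Fin l → Vec N → ℝ) (γ : ℝ) {s t : ℕ} (hs : s < S) (ht : t < m) {xs : Ω → Vec N}
    (hst : IsSimple (ℱ (s * m + t)) fun ω => innerLoop μ Y f γ (R ω) s (xs ω) t) :
    IsSimple (ℱ (s * m + t)) fun ω => readAt μ Y f γ (R ω) s (xs ω) t := by
  have hK := isSimple_pending hR hs ht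
  -- The sum over a random index set becomes a sum over the fixed `range t`, the indices for which
  -- `missed` is known to be measurable.
  have e : (fun ω => readAt μ Y f γ (R ω) s (xs ω) t) = fun ω =>
      (innerLoop μ Y f γ (R ω) s (xs ω) t).x + γ • ∑ i ∈ Finset.range t,
        if i ∈ (R ω).pending s t then
          restrict ((R ω).missed s t i) ((innerLoop μ Y f γ (R ω) s (xs ω) t).upd i)
        else 0 := by
    ext1 ω
    rw [readAt, readPoint, ← Finset.sum_filter, Finset.filter_mem_eq_inter,
      Finset.inter_eq_right.2 fun i hi => Finset.mem_range.2 (hR.delay ω s hs t ht i hi).1]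
  rw [e]
  refine hst.comp₂ (.sum _ fun i hi => ?_) fun st v => st.x + γ • v
  exact hK.comp₃ (.of_finite (hR.missed_meas s hs t ht i (Finset.mem_range.1 hi))) hst
    fun K B st => if i ∈ K then restrict B (st.upd i) else 0

theorem isSimple_innerLoop (hR : IsAsyncRun P ℱ mode Y τ S m R) (μ : Fin N → ℝ)
    (f : Fin l → Vec N → ℝ) (γ : ℝ) {s : ℕ} (hs : s < S) {xs : Ω → Vec N}
    (hxs : IsSimple (ℱ (s * m)) xs) {t : ℕ} (ht : t ≤ m) :
    IsSimple (ℱ (s * m + t)) fun ω => innerLoop μ Y f γ (R ω) s (xs ω) t := by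
  induction t with
  | zero => exact hxs.comp fun x => (⟨x, fun _ => 0⟩ : State N)
  | succ t ih =>
    have ht' : t < m := ht
    have hst := ih ht'.le
    have hle : ℱ (s * m + t) ≤ ℱ (s * m + (t + 1)) := ℱ.mono (by omega)
    have hv : IsSimple (ℱ (s * m + (t + 1))) fun ω =>
        estimate μ Y f ((R ω).batch s t) ((R ω).coords s t) (readAt μ Y f γ (R ω) s (xs ω) t)
          (xs ω) :=
      IsSimple.comp₃ (.of_finite (hR.batch_meas s hs t ht'))
        (.of_finite (hR.coords_meas s hs t ht'))
        (((isSimple_readAt hR μ f γ hs ht' hst).mono hle).comp₂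
          (hxs.mono (ℱ.mono (by omega))) Prod.mk)
        fun I J q => estimate μ Y f I J q.1 q.2
    exact (hst.mono hle).comp₂ hv fun st v =>
      (⟨st.x - γ • v, Function.update st.upd t v⟩ : State N)

theorem isSimple_outer (hR : IsAsyncRun P ℱ mode Y τ S m R) (μ : Fin N → ℝ)
    (f : Fin l → Vec N → ℝ) (γ : ℝ) (x₀ : Vec N) {s : ℕ} (hs : s ≤ S) :
    IsSimple (ℱ (s * m)) fun ω => outer μ Y f γ m x₀ (R ω) s := by
  induction s with
  | zero => exact .const x₀
  | succ s ih =>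
    rw [Nat.succ_mul]
    exact (isSimple_innerLoop hR μ f γ hs (ih (by omega)) le_rfl).comp State.x

theorem isSimple_iterate (hR : IsAsyncRun P ℱ mode Y τ S m R) (μ : Fin N → ℝ)
    (f : Fin l → Vec N → ℝ) (γ : ℝ) (x₀ : Vec N) {s t : ℕ} (hs : s < S) (ht : t ≤ m) :
    IsSimple (ℱ (s * m + t)) fun ω => iterate μ Y f γ m x₀ (R ω) s t :=
  (isSimple_innerLoop hR μ f γ hs (isSimple_outer hR μ f γ x₀ hs.le) ht).comp State.x

/-- The estimate is unbiased given the history. -/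
theorem integral_inner_updateAt_sub_eq_zero [IsProbabilityMeasure P]
    (hR : IsAsyncRun P ℱ mode Y τ S m R) {μ : Fin N → ℝ} {f : Fin l → Vec N → ℝ} {L : ℝ}
    (hf : ∀ i, Differentiable ℝ (f i))
    (hlip : ∀ i x y, ‖gradient (f i) x - gradient (f i) y‖ ≤ L * ‖x - y‖)
    (hj : ∀ j, L = 0 ∨ μ j = 0) (hY : 0 < Y) (hYN : Y ≤ N) (hb : 0 < b) (hbl : b ≤ l)
    (γ : ℝ) {s t : ℕ} (hs : s < S) (ht : t < m) {xs : Ω → Vec N}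
    (hxs : IsSimple (ℱ (s * m)) xs) :
    ∫ ω, inner ℝ (gradient (avg f) (innerLoop μ Y f γ (R ω) s (xs ω) t).x)
      (updateAt μ Y f γ (R ω) s (xs ω) t
        - gradient (avg f) (readAt μ Y f γ (R ω) s (xs ω) t)) ∂P = 0 := by
  have hst := isSimple_innerLoop hR μ f γ hs hxs ht.le
  have hZ : IsSimple (ℱ (s * m + t)) fun ω =>
      ((innerLoop μ Y f γ (R ω) s (xs ω) t).x, readAt μ Y f γ (R ω) s (xs ω) t, xs ω) :=
    (hst.comp State.x).comp₃ (isSimple_readAt hR μ f γ hs ht hst)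
      (hxs.mono (ℱ.mono (by omega))) fun x xh xs => (x, xh, xs)
  have hpow : (Finset.powersetCard Y (Finset.univ : Finset (Fin N))).Nonempty :=
    Finset.powersetCard_nonempty.2 (by simpa using hYN)
  have hpair : ∀ k : (Fin b → Fin l) × Finset (Fin N),
      {ω | ((R ω).batch s t, (R ω).coords s t) = k}
        = {ω | (R ω).batch s t = k.1 ∧ (R ω).coords s t = k.2} := fun k => by
    ext ω
    exact Prod.ext_iff
  refine integral_eq_zero_of_uniform (ℱ.le _) hZ (K := fun ω =>
    ((R ω).batch s t, (R ω).coords s t))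
    (D := batches mode b l ×ˢ Finset.powersetCard Y (Finset.univ : Finset (Fin N)))
    ((batches_nonempty (hb.trans_le hbl) hbl).product hpow) (fun k => ?_)
    (fun H hH k hk => ?_) (fun z k => inner ℝ (gradient (avg f) z.1)
      (estimate μ Y f k.1 k.2 z.2.1 z.2.2 - gradient (avg f) z.2.1)) fun z => ?_
  · rw [hpair]
    exact ℱ.le _ _ ((hR.batch_meas s hs t ht k.1).inter (hR.coords_meas s hs t ht k.2))
  · rw [Finset.mem_product] at hk
    rw [hpair, hR.uniform s hs t ht H hH k.1 hk.1 k.2 hk.2, Finset.card_product,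
      Finset.card_powersetCard, Finset.card_univ, Fintype.card_fin]
    push_cast
    ring
  · rw [← inner_sum, Finset.sum_sub_distrib, Finset.sum_product, Finset.sum_const,
      Finset.card_product, Finset.card_powersetCard, Finset.card_univ, Fintype.card_fin]
    simp_rw [estimate_eq_restrict hf hlip hj, sum_powersetCard_restrict hY hYN]
    rw [← Finset.smul_sum, sum_batches_fullEstimate hb hf, ← Nat.cast_smul_eq_nsmul ℝ, smul_smul,
      Nat.cast_mul, mul_comm, sub_self, inner_zero_right]

/-- Expected descent over one outer loop. -/
theorem integral_avg_outer_succ_le [IsProbabilityMeasure P]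
    (hR : IsAsyncRun P ℱ mode Y τ S m R) {μ : Fin N → ℝ} {f : Fin l → Vec N → ℝ} {L Lt γ u : ℝ}
    (hY : 0 < Y) (hYN : Y ≤ N) (hb : 0 < b) (hbl : b ≤ l)
    (hL : 0 ≤ L) (hLt : 0 < Lt) (hf : ∀ i, Differentiable ℝ (f i))
    (hlip : ∀ i x y, ‖gradient (f i) x - gradient (f i) y‖ ≤ L * ‖x - y‖)
    (hj : ∀ j, L = 0 ∨ μ j = 0)
    (hF : ∀ x y, ‖gradient (avg f) x - gradient (avg f) y‖ ≤ Lt * ‖x - y‖)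
    (hγ : 0 ≤ γ) (hγm : γ * m ≤ Y / (5 * (N : ℝ) ^ 2 * Lt)) (hγu : γ * Lt ≤ u)
    (hu1 : u ≤ 1) (hu : u * (4 * (((τ : ℝ) ^ 2 + 1) * updBound N Y L Lt)) ≤ 1)
    (x₀ : Vec N) {s : ℕ} (hs : s < S) :
    ∫ ω, avg f (outer μ Y f γ m x₀ (R ω) (s + 1)) ∂P
      ≤ ∫ ω, avg f (outer μ Y f γ m x₀ (R ω) s) ∂P
        - γ / 4 * ∑ t ∈ Finset.range m,
            ∫ ω, ‖gradient (avg f) (iterate μ Y f γ m x₀ (R ω) s t)‖ ^ 2 ∂P := by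
  have hxs := isSimple_outer hR μ f γ x₀ hs.le
  have hint : ∀ {n} {X : Ω → ℝ}, IsSimple (ℱ n) X → Integrable X P := fun h =>
    (h.mono (ℱ.le _)).integrable
  set xs := fun ω => outer μ Y f γ m x₀ (R ω) s with hxs_def
  set g := fun t ω => ‖gradient (avg f) (innerLoop μ Y f γ (R ω) s (xs ω) t).x‖ ^ 2 with hg
  set h := fun t ω => (inner ℝ (gradient (avg f) (innerLoop μ Y f γ (R ω) s (xs ω) t).x)
      (updateAt μ Y f γ (R ω) s (xs ω) t
        - gradient (avg f) (readAt μ Y f γ (R ω) s (xs ω) t)) : ℝ) with hh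
  have hgi : ∀ t ∈ Finset.range m, Integrable (g t) P := fun t ht =>
    hint ((isSimple_innerLoop hR μ f γ hs hxs (Finset.mem_range.1 ht).le).comp
      fun st => ‖gradient (avg f) st.x‖ ^ 2)
  have hhi : ∀ t ∈ Finset.range m, Integrable (h t) P := fun t ht => by
    have ht := Finset.mem_range.1 ht
    have hst := isSimple_innerLoop hR μ f γ hs hxs ht.le
    have hst' := isSimple_innerLoop hR μ f γ hs hxs (Nat.succ_le_of_lt ht)
    -- The update is recorded in the next state, so its simplicity follows from that of the state.
    have e : ∀ ω, updateAt μ Y f γ (R ω) s (xs ω) t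
        = (innerLoop μ Y f γ (R ω) s (xs ω) (t + 1)).upd t := fun ω =>
      (innerLoop_upd _ _ _ _ _ _ _ (Nat.lt_succ_self t)).symm
    simp only [hh, e]
    have hle : ℱ (s * m + t) ≤ ℱ (s * m + t.succ) := ℱ.mono (by omega)
    exact hint ((hst.mono hle).comp₃ hst' ((isSimple_readAt hR μ f γ hs ht hst).mono hle)
      fun st st' xh => (inner ℝ (gradient (avg f) st.x) (st'.upd t - gradient (avg f) xh) : ℝ))
  have hFi : Integrable (fun ω => avg f (xs ω)) P := hint (hxs.comp (avg f))
  have hFi' : Integrable (fun ω => avg f (outer μ Y f γ m x₀ (R ω) (s + 1))) P :=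
    hint ((isSimple_outer hR μ f γ x₀ hs).comp (avg f))
  have hhs : Integrable (fun ω => γ * ∑ t ∈ Finset.range m, h t ω) P :=
    (integrable_finsetSum _ hhi).const_mul γ
  have hgs : Integrable (fun ω => γ / 4 * ∑ t ∈ Finset.range m, g t ω) P :=
    (integrable_finsetSum _ hgi).const_mul _
  have hds : Integrable (fun ω => avg f (xs ω) - γ * ∑ t ∈ Finset.range m, h t ω) P :=
    hFi.sub hhs
  have hzero : ∀ t ∈ Finset.range m, ∫ ω, h t ω ∂P = 0 := fun t ht =>
    integral_inner_updateAt_sub_eq_zero hR hf hlip hj hY hYN hb hbl γ hs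
      (Finset.mem_range.1 ht) hxs
  calc _ ≤ ∫ ω, (avg f (xs ω) - γ * ∑ t ∈ Finset.range m, h t ω
          - γ / 4 * ∑ t ∈ Finset.range m, g t ω) ∂P :=
        integral_mono hFi' (hds.sub hgs) fun ω =>
          avg_innerLoop_le hL hLt hf hlip hj hF hγ hγm hγu hu1 hu (xs ω) (hR.delay ω s hs)
    _ = _ := by
        rw [integral_sub hds hgs, integral_sub hFi hhs, integral_const_mul,
          integral_const_mul, integral_finsetSum _ hhi, integral_finsetSum _ hgi,
          Finset.sum_eq_zero hzero, mul_zero, sub_zero]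
        rfl

end Run

/-! ### Choice of the constants and summation over the stages -/

theorem mul_le_of_lt_div_add_one {u A B : ℝ} (hB : 0 ≤ B) (hu : 0 < u)
    (h : u < A / (B + 1)) : u * B ≤ A := by
  rw [lt_div_iff₀ (by linarith)] at h
  nlinarith

end AsyDSZOVR

theorem corollary1
    (N Y τ : ℕ) (hY : 1 ≤ Y) (hYN : Y ≤ N)
    (L Lt Lh : ℝ) (hL : 0 ≤ L) (hLt : 0 < Lt) (hLh : 0 ≤ Lh) :
    ∃ ustar : ℝ, 0 < ustar ∧ ustar ≤ 1 ∧ ∀ u₀ : ℝ, 0 < u₀ → u₀ < ustar →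
    ∃ σ : ℝ, 0 < σ ∧
    ∀ (α : ℝ) (_ : 0 < α) (_ : α < 1)
      (l b : ℕ) (_ : 0 < b) (_ : (b : ℝ) < (l : ℝ) ^ α)
      (S m : ℕ) (_ : 0 < S) (_ : 0 < m)
      (_ : (m : ℝ) ≤ Y * (l : ℝ) ^ α / (5 * u₀ * b * (N : ℝ) ^ 2))
      -- step size and auxiliary sequences
      (γ : ℝ) (_ : γ = u₀ * b / (Lt * (l : ℝ) ^ α))
      (β : ℕ → ℝ) (_ : ∀ t < m, β t = Lt * (N : ℝ) ^ 2 / Y)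
      (c : ℕ → ℝ) (_ : c m = 0)
      (_ : ∀ t < m, c t = AsyDSZOVR.cStep N Y τ b L Lt γ (β t) (c (t + 1)))
      -- objective function and smoothing parameters
      (μ : Fin N → ℝ) (_ : ∀ j, 0 ≤ μ j)
      (f : Fin l → AsyDSZOVR.Vec N → ℝ) (_ : ∀ i, Differentiable ℝ (f i))
      (_ : ∀ i x y, ‖gradient (f i) x - gradient (f i) y‖ ≤ L * ‖x - y‖)
      (_ : ∀ x y, ‖AsyDSZOVR.mixGrad μ (AsyDSZOVR.avg f) x
        - AsyDSZOVR.mixGrad μ (AsyDSZOVR.avg f) y‖ ≤ Lt * ‖x - y‖)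
      (_ : ∀ x, ‖AsyDSZOVR.mixGrad μ (AsyDSZOVR.avg f) x‖
        ≤ Lh * ‖gradient (AsyDSZOVR.avg f) x‖)
      (_ : AsyDSZOVR.smoothingError L μ = 0)
      -- the run of the algorithm
      (x₀ : AsyDSZOVR.Vec N)
      (Ω : Type*) (mΩ : MeasurableSpace Ω) (P : Measure Ω) (_ : IsProbabilityMeasure P)
      (ℱ : Filtration ℕ mΩ) (mode : AsyDSZOVR.Sampling) (R : Ω → AsyDSZOVR.Path N l b)
      (_ : AsyDSZOVR.IsAsyncRun P ℱ mode Y τ S m R),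
      -- `σ` is the constant in the lower bound on `Γ_t`
      0 < AsyDSZOVR.gap N Y τ Lt γ ∧
      (∀ t < m, σ * b / (Lt * (l : ℝ) ^ α) ≤ AsyDSZOVR.Gam N Y τ L Lt Lh γ (c (t + 1))) ∧
      -- the expectations exist
      (∀ s < S, ∀ t < m, Integrable
        (fun ω => ‖gradient (AsyDSZOVR.avg f)
          (AsyDSZOVR.iterate μ Y f γ m x₀ (R ω) s t)‖ ^ 2) P) ∧
      Integrable (fun ω => AsyDSZOVR.avg f (AsyDSZOVR.outer μ Y f γ m x₀ (R ω) S)) P ∧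
      -- the rate, with `T = S * m`
      (1 / ((S * m : ℕ) : ℝ)) * ∑ s ∈ Finset.range S, ∑ t ∈ Finset.range m,
          ∫ ω, ‖gradient (AsyDSZOVR.avg f)
            (AsyDSZOVR.iterate μ Y f γ m x₀ (R ω) s t)‖ ^ 2 ∂P
        ≤ Lt * (l : ℝ) ^ α * (AsyDSZOVR.avg f x₀
            - ∫ ω, AsyDSZOVR.avg f (AsyDSZOVR.outer μ Y f γ m x₀ (R ω) S) ∂P)
          / (σ * b * ((S * m : ℕ) : ℝ)) := by
  have hN0 : 0 < N := hY.trans hYN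
  have hNr : (0 : ℝ) < N := by exact_mod_cast hN0
  have hYr : (0 : ℝ) < Y := by exact_mod_cast hY
  set B₁ : ℝ := 4 * N * (τ : ℝ) ^ 2 with hB₁
  set B₂ : ℝ := 32 * Lh * (AsyDSZOVR.cBound N Y τ L Lt * N / Y
    + (L * Y / (2 * N) + N * L ^ 2 * (τ : ℝ) ^ 2 / (Y * Lt))) with hB₂
  set B₃ : ℝ := 4 * (((τ : ℝ) ^ 2 + 1) * AsyDSZOVR.updBound N Y L Lt) with hB₃
  have h₁ : 0 ≤ B₁ := by positivity
  have h₂ : 0 ≤ B₂ := by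
    have : 0 ≤ AsyDSZOVR.cBound N Y τ L Lt := by unfold AsyDSZOVR.cBound; positivity
    positivity
  have h₃ : 0 ≤ B₃ := by
    have := AsyDSZOVR.updBound_nonneg N Y L Lt
    positivity
  -- The three quotients ensure in turn `gap ≥ Y / 2`, `Γ_t ≥ γ / 4` and the pathwise descent; the
  -- `+ 1` keeps the denominators positive when some `B` vanishes.
  refine ⟨min 1 (min (Y / (B₁ + 1)) (min (Lt / (B₂ + 1)) (1 / (B₃ + 1)))),
    lt_min one_pos (lt_min (by positivity) (lt_min (by positivity) (by positivity))),
    min_le_left _ _, fun u hu0 hu => ⟨u / 4, by positivity, ?_⟩⟩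
  simp only [lt_min_iff] at hu
  obtain ⟨hu1, hu2, hu3, hu4⟩ := hu
  replace hu2 := AsyDSZOVR.mul_le_of_lt_div_add_one h₁ hu0 hu2
  replace hu3 := AsyDSZOVR.mul_le_of_lt_div_add_one h₂ hu0 hu3
  replace hu4 := AsyDSZOVR.mul_le_of_lt_div_add_one h₃ hu0 hu4
  intro α hα hα1 l b hb hbl S m hS hm hmle γ hγ β hβ c hcm hc μ hμ f hf hlip hmixLip hmixBd hω x₀
    Ω mΩ P hP ℱ mode R hR
  have hb' : (0 : ℝ) < b := by exact_mod_cast hb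
  have hlα : 0 < (l : ℝ) ^ α := hb'.trans hbl
  have hl : 0 < l := by
    rcases Nat.eq_zero_or_pos l with rfl | h
    · rw [Nat.cast_zero, Real.zero_rpow hα.ne'] at hlα
      exact absurd hlα (lt_irrefl _)
    · exact h
  have hbl' : b ≤ l := by
    have h1 : (1 : ℝ) ≤ l := by exact_mod_cast hl
    have h2 : (l : ℝ) ^ α ≤ l := by
      simpa using Real.rpow_le_rpow_of_exponent_le h1 hα1.le
    exact_mod_cast hbl.le.trans h2
  have hγ0 : 0 < γ := by rw [hγ]; positivity
  have hγu : γ * Lt ≤ u := by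
    calc γ * Lt = u * (b / (l : ℝ) ^ α) := by rw [hγ]; field_simp
      _ ≤ u * 1 := by
        gcongr
        exact (div_le_one hlα).2 hbl.le
      _ = u := mul_one u
  have hγ1 : γ * Lt ≤ 1 := hγu.trans hu1.le
  have hγm : γ * m ≤ Y / (5 * (N : ℝ) ^ 2 * Lt) := by
    calc γ * m ≤ γ * (Y * (l : ℝ) ^ α / (5 * u * b * (N : ℝ) ^ 2)) := by gcongr
      _ = _ := by rw [hγ]; field_simp
  have hgap := AsyDSZOVR.half_le_gap (N := N) (Y := Y) (τ := τ) hLt hγ0.le hγu hu1.le hu2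
  have hj := AsyDSZOVR.eq_zero_or_eq_zero_of_smoothingError hω
  have hF : ∀ x y, ‖gradient (AsyDSZOVR.avg f) x - gradient (AsyDSZOVR.avg f) y‖
      ≤ Lt * ‖x - y‖ := fun x y => by
    have h := hmixLip x y
    rwa [AsyDSZOVR.mixGrad_eq_gradient (AsyDSZOVR.differentiable_avg hf)
      (AsyDSZOVR.norm_gradient_avg_sub_le hL hf hlip) hj,
      AsyDSZOVR.mixGrad_eq_gradient (AsyDSZOVR.differentiable_avg hf)
      (AsyDSZOVR.norm_gradient_avg_sub_le hL hf hlip) hj] at h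
  -- This is where `σ = u / 4` comes from.
  have hσ : u / 4 * b / (Lt * (l : ℝ) ^ α) = γ / 4 := by rw [hγ]; ring
  refine ⟨by linarith, fun t ht => ?_, fun s hs t ht => ?_, ?_, ?_⟩
  · obtain ⟨hc0, hcC⟩ := AsyDSZOVR.c_le_cBound hN0 hY hb hL hLt hγ0.le hγ1 hγm hgap hβ hcm hc
      (t + 1) ht
    rw [hσ]
    exact AsyDSZOVR.quarter_le_Gam hY hL hLt hLh hγ0.le hγu hu1.le hgap hc0 hcC hu3
  · exact (((AsyDSZOVR.isSimple_iterate hR μ f γ x₀ hs ht.le).comp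
      fun x => ‖gradient (AsyDSZOVR.avg f) x‖ ^ 2).mono (ℱ.le _)).integrable
  · exact (((AsyDSZOVR.isSimple_outer hR μ f γ x₀ le_rfl).comp (AsyDSZOVR.avg f)).mono
      (ℱ.le _)).integrable
  · have htel : ∀ n ≤ S, γ / 4 * ∑ s ∈ Finset.range n, ∑ t ∈ Finset.range m,
        ∫ ω, ‖gradient (AsyDSZOVR.avg f) (AsyDSZOVR.iterate μ Y f γ m x₀ (R ω) s t)‖ ^ 2 ∂P
        ≤ AsyDSZOVR.avg f x₀
          - ∫ ω, AsyDSZOVR.avg f (AsyDSZOVR.outer μ Y f γ m x₀ (R ω) n) ∂P := by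
      intro n
      induction n with
      | zero => simp [AsyDSZOVR.outer]
      | succ n ih =>
        intro hn
        have h1 := ih (by omega)
        have h2 := AsyDSZOVR.integral_avg_outer_succ_le hR hY hYN hb hbl' hL hLt hf hlip hj hF
          hγ0.le hγm hγu hu1.le hu4 x₀ (s := n) hn
        rw [Finset.sum_range_succ, mul_add]
        linarith
    have hT : (0 : ℝ) < ((S * m : ℕ) : ℝ) := by exact_mod_cast Nat.mul_pos hS hm
    set Q := ∑ s ∈ Finset.range S, ∑ t ∈ Finset.range m,
      ∫ ω, ‖gradient (AsyDSZOVR.avg f) (AsyDSZOVR.iterate μ Y f γ m x₀ (R ω) s t)‖ ^ 2 ∂P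
    set Δ := AsyDSZOVR.avg f x₀
      - ∫ ω, AsyDSZOVR.avg f (AsyDSZOVR.outer μ Y f γ m x₀ (R ω) S) ∂P
    have hfin : γ / 4 * Q ≤ Δ := htel S le_rfl
    calc 1 / ((S * m : ℕ) : ℝ) * Q
        = Lt * (l : ℝ) ^ α * (γ / 4 * Q) / (u / 4 * b * ((S * m : ℕ) : ℝ)) := by
          rw [← hσ]
          field_simp
      _ ≤ _ := by gcongr
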